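/- Let $n\in\mathbb N$ and $p,q\in(0,1)$. Consider $n$ independent edges, each of which alternates between on and off in discrete time $k=1,2,\dots$: the successive on-times are iid with $\mathbb P(X\ge i)=(1-p)^{i-1}$, the successive off-times are iid with $\mathbb P(Y\ge i)=(1-q)^{i-1}$ ($i\ge1$), on- and off-times are independent, and the process is stationary: at time $1$ an edge is on with probability $\varrho=\mathbb EX/(\mathbb EX+\mathbb EY)=q/(p+q)$ and off otherwise, the residual on-time has masses $\mathbb P(X\ge k)/\mathbb EX$ and the residual off-time has masses $\mathbb P(Y\ge k)/\mathbb EY$, $k\ge 1$. Let $A(k)$ be the number of edges that are on at time $k$, let $$\hat\mu_K(0)=\frac1K\sum_{k=1}^KA(k),\qquad \hat\mu_K(1)=\frac1{K-1}\sum_{k=1}^{K-1}A(k)A(k+1),$$ and $s_0=\mathbb EA(k)$, $s_1=\mathbb E[A(k)A(k+1)]$. Then $\sqrt K\,(\hat\mu_K(0)-s_0,\ \hat\mu_K(1)-s_1)$ converges in distribution, as $K\to\infty$, to a centered bivariate (possibly degenerate) normal vector $(Z_0,Z_1)$; its (co)variances $v_0=\mathrm{Var}\,Z_0$, $v_1=\mathrm{Var}\,Z_1$,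 $c_{01}=\mathrm{Cov}(Z_0,Z_1)$ satisfy $$v_0=\lim_{K\to\infty}\tfrac1K\mathrm{Var}\Big[\sum_{k=1}^KA(k)\Big],\quad v_1=\lim_{K\to\infty}\tfrac1K\mathrm{Var}\Big[\sum_{k=1}^{K-1}A(k)A(k+1)\Big],\quad c_{01}=\lim_{K\to\infty}\tfrac1K\mathrm{Cov}\Big[\sum_{k=1}^KA(k),\sum_{k=1}^{K-1}A(k)A(k+1)\Big],$$ and they have the following closed forms. Put $f=1-p-q$, and let $m_i=\mathbb E[A(1)^i]=\sum_{a=0}^n\binom na\varrho^a(1-\varrho)^{n-a}a^i$ and $\mathfrak m_i=\mathbb E[A(1)A(2)^i]$, which are given by $$\mathfrak m_1=f m_2+nq\,m_1,\qquad \mathfrak m_2=f^2m_3+f(p-q+2nq)m_2+(nq(1-q)+n^2q^2)m_1,$$ $$\mathfrak m_3=f^3m_4+3f^2(p-q+nq)m_3+f(3n^2q^2+3npq-6nq^2+3nq+2p^2-2pq-p+2q^2-q)m_2+(n(n-1)(n-2)q^3+3n(n-1)q^2+nq)m_1.$$ First, $$v_0=n\varrho(1-\varrho)\frac{1+f}{1-f}=n\,\frac{pq(2-p-q)}{(p+q)^3}.$$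 Second, with $t_k=\mathrm{Cov}(A(1)A(2),A(k)A(k+1))$, the series $\sum_{k\ge2}t_k$ converges absolutely and $$v_1=t_1+2\sum_{k=2}^\infty t_k=t_1+2\Big(\mathfrak c_1\frac{f^2}{1-f}+\mathfrak c_2\frac{f^4}{1-f^2}\Big),$$ where $t_1=f^2m_4+f(p-q+2nq)m_3+(nq(1-q)+n^2q^2)m_2-\mathfrak m_1^2$ and $$\mathfrak c_1=\frac{f(1-2\varrho)+n\varrho(1+f)}{f^2}\,\mathfrak m_2-\frac{nf\varrho(1-2\varrho)+n^2\varrho^2(1+f)}{f^2}\,\mathfrak m_1,\qquad \mathfrak c_2=\frac1{f^3}\mathfrak m_3+\frac{2\varrho-1-2n\varrho}{f^3}\mathfrak m_2+\frac{n\varrho^2(n-1)}{f^3}\mathfrak m_1.$$ Third, $$c_{01}=\mathfrak d_1\frac f{1-f}+\mathfrak d_2\frac{f^2}{1-f^2}+\Big(\mathfrak m_2\frac1{f^2}-\mathfrak m_1\frac{n\varrho}{f^2}\Big)\frac{f^2}{1-f},$$ where $$\mathfrak d_1=\frac{f-2f\varrho+nq+2fn\varrho}{f}\,(m_2-n\varrho\,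 m_1),\qquad \mathfrak d_2=\frac1f m_3-\frac{2n\varrho-2\varrho+1}{f}m_2+\frac{n\varrho^2(n-1)}{f}m_1.$$ If $f=0$, i.e. $p+q=1$, the expressions for $v_1$ and $c_{01}$ are read after cancelling the powers of $f$ against those in the denominators. -/

import Mathlib

open MeasureTheory ProbabilityTheory Filter Topology

namespace OnOff

/-! ### The stationary alternating on/off process of one edge -/

/-- The geometric law on `{1, 2, …}` with success probability `p`:
`P(Z = k + 1) = (1 - p) ^ k * p`, equivalently `P(Z ≥ i) = (1 - p) ^ (i - 1)`. -/
noncomputable def geomLaw (p : ℝ) : Measure ℕ :=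
  Measure.sum fun k : ℕ => ENNReal.ofReal ((1 - p) ^ k * p) • Measure.dirac (k + 1)

/-- The mean of a law on `ℕ`. -/
noncomputable def mean (F : Measure ℕ) : ENNReal := ∫⁻ x, (x : ENNReal) ∂F

/-- The residual law of `F`: mass `P(X ≥ k) / E X` at every `k = 1, 2, …`. -/
noncomputable def residualLaw (F : Measure ℕ) : Measure ℕ :=
  Measure.sum fun k : ℕ => (F {l | k + 1 ≤ l} / mean F) • Measure.dirac (k + 1)

/-- The stationary on-probability `E X / (E X + E Y)`. -/
noncomputable def onProb (F G : Measure ℕ) : ENNReal := mean F / (mean F + mean G)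

/-- The primitive data of one edge: its state at time `1` (`true` is on) and the residual duration
of that state, the sequence of later on-times, and the sequence of later off-times. -/
abbrev EdgeData : Type := (Bool × ℕ) × (ℕ → ℕ) × (ℕ → ℕ)

/-- The stationary law of the state at time `1` and its residual duration. -/
noncomputable def initLaw (F G : Measure ℕ) : Measure (Bool × ℕ) :=
  onProb F G • (Measure.dirac true).prod (residualLaw F) +
    (1 - onProb F G) • (Measure.dirac false).prod (residualLaw G)

/-- The law of the data of one edge: the initial data are stationary, the on-times are iid with
law `F`, the off-times are iid with law `G`, and these three are independent. -/
noncomputable def edgeLaw (F G : Measure ℕ) : Measure EdgeData :=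
  (initLaw F G).prod
    ((Measure.infinitePi fun _ : ℕ => F).prod (Measure.infinitePi fun _ : ℕ => G))

/-- The state during the `m`-th sojourn (`m = 0` is the residual one): states alternate. -/
def phase (e : EdgeData) : ℕ → Bool
  | 0 => e.1.1
  | m + 1 => !(phase e m)

/-- The duration of the `m`-th sojourn. Of the sojourns `1, 2, 3, 4, …` every second one is an
on-sojourn and every second one an off-sojourn, so that each on-time and each off-time is
used exactly once. -/
def sojourn (e : EdgeData) : ℕ → ℕ
  | 0 => e.1.2
  | m + 1 => if phase e (m + 1) = true then e.2.1 (m / 2) else e.2.2 (m / 2)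

/-- The last time that belongs to the sojourns `0, …, m - 1`. -/
def elapsed (e : EdgeData) (m : ℕ) : ℕ := ∑ i ∈ Finset.range m, sojourn e i

/-- The edge is on at time `k ≥ 1`: `k` belongs to a sojourn in the state on. -/
def IsOn (e : EdgeData) (k : ℕ) : Prop :=
  ∃ m, phase e m = true ∧ elapsed e m < k ∧ k ≤ elapsed e (m + 1)

open Classical in
/-- The indicator of the edge being on at time `k`. -/
noncomputable def onInd (e : EdgeData) (k : ℕ) : ℝ := if IsOn e k then 1 else 0

/-! ### The dynamic random graph with `n` edges -/

/-- The `n` edges evolve independently, each as a stationary alternating renewal process with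
on-time law `F` and off-time law `G`. -/
structure IsStationaryGraph {Ω : Type*} [MeasurableSpace Ω] (P : Measure Ω) (F G : Measure ℕ)
    {n : ℕ} (ξ : Fin n → Ω → EdgeData) : Prop where
  indep : iIndepFun ξ P
  law : ∀ j, HasLaw (ξ j) (edgeLaw F G) P

/-- The number of edges that are on at time `k`. -/
noncomputable def edgeCount {Ω : Type*} {n : ℕ} (ξ : Fin n → Ω → EdgeData) (k : ℕ) (ω : Ω) : ℝ :=
  ∑ j, onInd (ξ j ω) k

/-- `A(k)` for `ℓ = 0`, and `A(k) A(k + ℓ)` for `ℓ ≥ 1`. -/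
noncomputable def lagTerm {Ω : Type*} {n : ℕ} (ξ : Fin n → Ω → EdgeData) (ℓ k : ℕ) (ω : Ω) : ℝ :=
  if ℓ = 0 then edgeCount ξ k ω else edgeCount ξ k ω * edgeCount ξ (k + ℓ) ω

/-- The sum of the lag terms over `k = 1, …, K - ℓ`. -/
noncomputable def lagSum {Ω : Type*} {n : ℕ} (ξ : Fin n → Ω → EdgeData) (ℓ K : ℕ) (ω : Ω) : ℝ :=
  ∑ k ∈ Finset.Icc 1 (K - ℓ), lagTerm ξ ℓ k ω

/-- The empirical moment: the average of the lag terms over `k = 1, …, K - ℓ`. -/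
noncomputable def muHat {Ω : Type*} {n : ℕ} (ξ : Fin n → Ω → EdgeData) (ℓ K : ℕ) (ω : Ω) : ℝ :=
  lagSum ξ ℓ K ω / ((K - ℓ : ℕ) : ℝ)

/-- The expectation of the lag terms. -/
noncomputable def lagMean {Ω : Type*} [MeasurableSpace Ω] (P : Measure Ω) {n : ℕ}
    (ξ : Fin n → Ω → EdgeData) (ℓ : ℕ) : ℝ :=
  ∫ ω, lagTerm ξ ℓ 1 ω ∂P

/-- The rescaled error `√K (μ̂_K(0) - s_0, μ̂_K(1) - s_1)` of the first two empirical moments. -/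
noncomputable def scaledError {Ω : Type*} [MeasurableSpace Ω] (P : Measure Ω) {n : ℕ}
    (ξ : Fin n → Ω → EdgeData) (K : ℕ) (ω : Ω) : EuclideanSpace ℝ (Fin 2) :=
  !₂[√(K : ℝ) * (muHat ξ 0 K ω - lagMean P ξ 0), √(K : ℝ) * (muHat ξ 1 K ω - lagMean P ξ 1)]

/-- `t_k = Cov(A(1) A(2), A(k) A(k + 1))`. -/
noncomputable def lagCov {Ω : Type*} [MeasurableSpace Ω] (P : Measure Ω) {n : ℕ}
    (ξ : Fin n → Ω → EdgeData) (k : ℕ) : ℝ :=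
  cov[lagTerm ξ 1 1, lagTerm ξ 1 k; P]

/-! ### The closed forms for geometric on- and off-times -/

/-- `ϱ = q / (p + q)`. -/
noncomputable def rho (p q : ℝ) : ℝ := q / (p + q)

/-- `f = 1 - p - q`. -/
def ff (p q : ℝ) : ℝ := 1 - p - q

/-- `m_i`, the `i`-th moment of the binomial law with parameters `n` and `ϱ`. -/
noncomputable def binMoment (n : ℕ) (p q : ℝ) (i : ℕ) : ℝ :=
  ∑ a ∈ Finset.range (n + 1),
    (n.choose a : ℝ) * rho p q ^ a * (1 - rho p q) ^ (n - a) * (a : ℝ) ^ i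

/-- The closed form of `𝔪₁ = E[A(1) A(2)]`. -/
noncomputable def jointMoment1 (n : ℕ) (p q : ℝ) : ℝ :=
  ff p q * binMoment n p q 2 + n * q * binMoment n p q 1

/-- The closed form of `𝔪₂ = E[A(1) A(2)²]`. -/
noncomputable def jointMoment2 (n : ℕ) (p q : ℝ) : ℝ :=
  ff p q ^ 2 * binMoment n p q 3 + ff p q * (p - q + 2 * n * q) * binMoment n p q 2
    + (n * q * (1 - q) + n ^ 2 * q ^ 2) * binMoment n p q 1

/-- The closed form of `𝔪₃ = E[A(1) A(2)³]`. -/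
noncomputable def jointMoment3 (n : ℕ) (p q : ℝ) : ℝ :=
  ff p q ^ 3 * binMoment n p q 4
    + 3 * ff p q ^ 2 * (p - q + n * q) * binMoment n p q 3
    + ff p q * (3 * n ^ 2 * q ^ 2 + 3 * n * p * q - 6 * n * q ^ 2 + 3 * n * q + 2 * p ^ 2
        - 2 * p * q - p + 2 * q ^ 2 - q) * binMoment n p q 2
    + (n * (n - 1) * (n - 2) * q ^ 3 + 3 * n * (n - 1) * q ^ 2 + n * q) * binMoment n p q 1

/-- The closed form of `t₁ = Var[A(1) A(2)]`. -/
noncomputable def t1Form (n : ℕ) (p q : ℝ) : ℝ :=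
  ff p q ^ 2 * binMoment n p q 4 + ff p q * (p - q + 2 * n * q) * binMoment n p q 3
    + (n * q * (1 - q) + n ^ 2 * q ^ 2) * binMoment n p q 2 - jointMoment1 n p q ^ 2

/-- The coefficient `𝔠₁` (for `f ≠ 0`). -/
noncomputable def c1 (n : ℕ) (p q : ℝ) : ℝ :=
  (ff p q * (1 - 2 * rho p q) + n * rho p q * (1 + ff p q)) / ff p q ^ 2 * jointMoment2 n p q
    - (n * ff p q * rho p q * (1 - 2 * rho p q) + n ^ 2 * rho p q ^ 2 * (1 + ff p q))
        / ff p q ^ 2 * jointMoment1 n p q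

/-- The coefficient `𝔠₂` (for `f ≠ 0`). -/
noncomputable def c2 (n : ℕ) (p q : ℝ) : ℝ :=
  1 / ff p q ^ 3 * jointMoment3 n p q
    + (2 * rho p q - 1 - 2 * n * rho p q) / ff p q ^ 3 * jointMoment2 n p q
    + n * rho p q ^ 2 * (n - 1) / ff p q ^ 3 * jointMoment1 n p q

/-- The coefficient `𝔡₁` (for `f ≠ 0`). -/
noncomputable def d1 (n : ℕ) (p q : ℝ) : ℝ :=
  (ff p q - 2 * ff p q * rho p q + n * q + 2 * ff p q * n * rho p q) / ff p q
      * binMoment n p q 2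
    - n * rho p q * (ff p q - 2 * ff p q * rho p q + n * q + 2 * ff p q * n * rho p q) / ff p q
      * binMoment n p q 1

/-- The coefficient `𝔡₂` (for `f ≠ 0`). -/
noncomputable def d2 (n : ℕ) (p q : ℝ) : ℝ :=
  1 / ff p q * binMoment n p q 3
    - (2 * n * rho p q - 2 * rho p q + 1) / ff p q * binMoment n p q 2
    + n * rho p q ^ 2 * (n - 1) / ff p q * binMoment n p q 1

/-- The closed form of `v₁` (for `f ≠ 0`). -/
noncomputable def v1Form (n : ℕ) (p q : ℝ) : ℝ :=
  t1Form n p q + 2 * (c1 n p q * (ff p q ^ 2 / (1 - ff p q))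
    + c2 n p q * (ff p q ^ 4 / (1 - ff p q ^ 2)))

/-- The closed form of `c₀₁` (for `f ≠ 0`). -/
noncomputable def c01Form (n : ℕ) (p q : ℝ) : ℝ :=
  d1 n p q * (ff p q / (1 - ff p q)) + d2 n p q * (ff p q ^ 2 / (1 - ff p q ^ 2))
    + (jointMoment2 n p q * (1 / ff p q ^ 2) - jointMoment1 n p q * (n * rho p q / ff p q ^ 2))
      * (ff p q ^ 2 / (1 - ff p q))

/-- The closed form of `v₁` with the powers of `f` in the denominators cancelled, so that it makes
sense for `f = 0` too. -/
noncomputable def v1Cancelled (n : ℕ) (p q : ℝ) : ℝ :=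
  t1Form n p q + 2 *
    (((ff p q * (1 - 2 * rho p q) + n * rho p q * (1 + ff p q))
        * (jointMoment2 n p q - n * rho p q * jointMoment1 n p q)) / (1 - ff p q)
      + ff p q * (jointMoment3 n p q + (2 * rho p q - 1 - 2 * n * rho p q) * jointMoment2 n p q
        + n * rho p q ^ 2 * (n - 1) * jointMoment1 n p q) / (1 - ff p q ^ 2))

/-- The closed form of `c₀₁` with the powers of `f` in the denominators cancelled, so that it makes
sense for `f = 0` too. -/
noncomputable def c01Cancelled (n : ℕ) (p q : ℝ) : ℝ :=
  ((ff p q - 2 * ff p q * rho p q + n * q + 2 * ff p q * n * rho p q)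
      * (binMoment n p q 2 - n * rho p q * binMoment n p q 1)) / (1 - ff p q)
    + ff p q * (binMoment n p q 3 - (2 * n * rho p q - 2 * rho p q + 1) * binMoment n p q 2
        + n * rho p q ^ 2 * (n - 1) * binMoment n p q 1) / (1 - ff p q ^ 2)
    + (jointMoment2 n p q - n * rho p q * jointMoment1 n p q) / (1 - ff p q)

end OnOff

/-! Geometric times have no memory, so the residual law of a geometric law is that law itself.
Shifting time by one unit (`step`) therefore sends the law of an edge with a given state to a
mixture of such laws, and the on/off state is a two-state Markov chain (`map_step_startLaw`). With
`n` independent edges the states form a chain on `Fin n → Bool` with strictly positive transition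
probabilities `trans` and stationary product Bernoulli weights `stat` (`isMarkovShift`), and `A(k)`
and `A(k) A(k + 1)` are functions of two consecutive states of it.

A transition multiplies each centred on-indicator by `f`. Hence the centred count `eigenLin` has
eigenvalue `f`, and `eigenQuad`, the sum of products of centred indicators of distinct edges, has
eigenvalue `f ^ 2`. The conditional means of both summands given the first state lie in the span of
these two functions and the constants (`sum_trans_const`, `sum_trans_mul`). So every covariance at
positive lag is a combination of `f ^ k` and `f ^ (2 * k)`, and summing geometric series gives the
limits of the normalized covariances (`tendsto_covariance_pair`) and, after inserting binomial
moments, the closed forms.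

For normality, the characteristic function of a path sum is the stationary mean of the `N`-th power
of a transfer operator applied to `1`. At `θ = 1 / √N` that operator has the approximate eigenvector
`1 + iθu + θ²v` and the approximate eigenvalue `1 - θ²s/2`, where `u` and `v` solve Poisson
equations. The error is `O(θ³)` per step and the operators are contractions, so `N` steps cost `O(1
/ √N)` and the limit is `exp (-s / 2)` (`tendsto_transfer_pow`). Applied to every linear combination
of the two summands, this gives the Gaussian limit of the joint characteristic functions. -/

namespace OnOff

/-! ### Splitting off the first term of an iid sequence -/

/-- Prepends a term to a sequence. -/
def seqCons (z : ℕ × (ℕ → ℕ)) : ℕ → ℕ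
  | 0 => z.1
  | i + 1 => z.2 i

lemma measurable_seqCons : Measurable seqCons := by
  refine measurable_pi_lambda _ fun i => ?_
  cases i with
  | zero => exact measurable_fst
  | succ i => exact (measurable_pi_apply i).comp measurable_snd

/-- Used when a sojourn ends: the next duration is the head of a sequence, and the tail must again
be iid and independent of it. -/
lemma infinitePi_eq_map_seqCons (G : Measure ℕ) [IsProbabilityMeasure G] :
    Measure.infinitePi (fun _ : ℕ => G)
      = (G.prod (Measure.infinitePi fun _ : ℕ => G)).map seqCons := by
  refine (Measure.eq_infinitePi _ fun s t _ => ?_).symm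
  -- Enlarging `s` to an initial segment, with trivial conditions at the new indices, makes the
  -- preimage of the cylinder under `seqCons` a rectangle: head times shifted cylinder.
  obtain ⟨N, hN⟩ : ∃ N, s ⊆ Finset.range (N + 1) :=
    ⟨s.sup id, fun i hi => Finset.mem_range.2 (Nat.lt_succ_of_le (Finset.le_sup (f := id) hi))⟩
  classical
  let t' : ℕ → Set ℕ := fun i => if i ∈ s then t i else Set.univ
  have h1 : Set.pi (s : Set ℕ) t = Set.pi (Finset.range (N + 1) : Set ℕ) t' := by
    ext x
    simp only [Set.mem_pi, Finset.mem_coe, t']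
    refine ⟨fun h i _ => ?_, fun h i hi => ?_⟩
    · split_ifs with hi
      · exact h i hi
      · trivial
    · simpa [hi] using h i (hN hi)
  have h2 : ∏ i ∈ s, G (t i) = ∏ i ∈ Finset.range (N + 1), G (t' i) := by
    rw [← Finset.prod_subset hN (f := fun i => G (t' i))]
    · exact Finset.prod_congr rfl fun i hi => by simp [t', hi]
    · intro i _ hi
      simp [t', hi]
  have h3 : seqCons ⁻¹' Set.pi (Finset.range (N + 1) : Set ℕ) t'
      = t' 0 ×ˢ Set.pi (Finset.range N : Set ℕ) (fun i => t' (i + 1)) := by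
    ext x
    simp only [Set.mem_preimage, Set.mem_pi, Finset.coe_range, Set.mem_Iio, Set.mem_prod]
    refine ⟨fun h => ⟨h 0 (by omega), fun i hi => h (i + 1) (by omega)⟩, fun h i hi => ?_⟩
    cases i with
    | zero => exact h.1
    | succ i => exact h.2 i (by omega)
  rw [h1, h2, Measure.map_apply measurable_seqCons
      (MeasurableSet.pi (Finset.countable_toSet _) fun _ _ => .of_discrete), h3,
    Measure.prod_prod, Measure.infinitePi_pi _ (fun _ _ => .of_discrete),
    Finset.prod_range_succ', mul_comm]

/-! ### Geometric laws and the absence of memory -/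

section Geometric

variable {p : ℝ}

lemma geomLaw_tail (hp : p ∈ Set.Ioo (0 : ℝ) 1) (k : ℕ) :
    geomLaw p {l | k + 1 ≤ l} = ENNReal.ofReal ((1 - p) ^ k) := by
  have h0 : 0 ≤ 1 - p := by linarith [hp.2]
  have hs : HasSum (fun j : ℕ => (1 - p) ^ (j + k) * p) ((1 - p) ^ k) := by
    have := ((hasSum_geometric_of_lt_one h0 (by linarith [hp.1])).mul_left ((1 - p) ^ k * p))
    have hp0 : p ≠ 0 := hp.1.ne'
    rw [sub_sub_cancel, mul_assoc, mul_inv_cancel₀ hp0, mul_one] at this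
    have h : (fun j : ℕ => (1 - p) ^ (j + k) * p) = fun j => (1 - p) ^ k * p * (1 - p) ^ j := by
      ext j; rw [pow_add]; ring
    rwa [h]
  rw [geomLaw, Measure.sum_apply _ .of_discrete]
  have : ∀ j, (ENNReal.ofReal ((1 - p) ^ j * p) • Measure.dirac (j + 1)) {l : ℕ | k + 1 ≤ l}
      = if j < k then 0 else ENNReal.ofReal ((1 - p) ^ j * p) := by
    intro j
    rw [Measure.smul_apply, Measure.dirac_apply' _ .of_discrete, Set.indicator_apply]
    by_cases h : j < k
    · rw [if_neg (by simp; omega), if_pos h]; simp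
    · rw [if_pos (by simp; omega), if_neg h]; simp
  simp_rw [this]
  rw [← ENNReal.summable.sum_add_tsum_nat_add' (k := k), Finset.sum_eq_zero, zero_add,
    ← hs.tsum_eq, ENNReal.ofReal_tsum_of_nonneg _ hs.summable]
  · refine tsum_congr fun j => ?_
    rw [if_neg (by omega)]
  · intro j; have := hp.1; positivity
  · intro j hj
    rw [if_pos (by simpa using hj)]

lemma ae_geomLaw_pos (p : ℝ) : ∀ᵐ l ∂geomLaw p, 1 ≤ l := by
  rw [geomLaw, Measure.ae_sum_iff' .of_discrete]
  intro k
  refine Measure.ae_smul_measure ?_ _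
  rw [ae_dirac_iff .of_discrete]
  omega

lemma isProbabilityMeasure_geomLaw (hp : p ∈ Set.Ioo (0 : ℝ) 1) :
    IsProbabilityMeasure (geomLaw p) := by
  refine ⟨?_⟩
  have := geomLaw_tail hp 0
  rw [pow_zero, ENNReal.ofReal_one] at this
  rw [← this]
  refine measure_congr ?_
  filter_upwards [ae_geomLaw_pos p] with l hl
  exact propext ⟨fun _ => show 0 + 1 ≤ l by omega, fun _ => trivial⟩

/-- Absence of memory: the duration is `1` with probability `p`, and otherwise exceeds a fresh copy
by one. The Markov property of an edge rests on this identity. -/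
lemma geomLaw_eq_add (hp : p ∈ Set.Ioo (0 : ℝ) 1) :
    geomLaw p = ENNReal.ofReal p • Measure.dirac 1
      + ENNReal.ofReal (1 - p) • (geomLaw p).map (· + 1) := by
  ext s hs
  rw [Measure.add_apply, Measure.smul_apply, Measure.smul_apply,
    Measure.map_apply .of_discrete hs]
  simp only [geomLaw]
  rw [Measure.sum_apply _ hs, Measure.sum_apply _ .of_discrete,
    ← ENNReal.summable.sum_add_tsum_nat_add' (k := 1), smul_eq_mul, smul_eq_mul,
    ← ENNReal.tsum_mul_left]
  simp only [Finset.range_one, Finset.sum_singleton, pow_zero, one_mul, zero_add,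
    Measure.smul_apply, smul_eq_mul]
  congr 1
  refine tsum_congr fun k => ?_
  rw [← mul_assoc, ← ENNReal.ofReal_mul (by linarith [hp.2]), pow_succ' (1 - p), mul_assoc,
    Measure.dirac_apply' _ hs, Measure.dirac_apply' _ .of_discrete]
  rfl

lemma mean_geomLaw (hp : p ∈ Set.Ioo (0 : ℝ) 1) : mean (geomLaw p) = ENNReal.ofReal p⁻¹ := by
  have h0 : 0 ≤ 1 - p := by linarith [hp.2]
  have h1 : ‖1 - p‖ < 1 := by rw [Real.norm_of_nonneg h0]; linarith [hp.1]
  have hp0 : p ≠ 0 := hp.1.ne'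
  have hs : HasSum (fun k : ℕ => (1 - p) ^ k * p * ((k + 1 : ℕ) : ℝ)) p⁻¹ := by
    have := ((hasSum_coe_mul_geometric_of_norm_lt_one h1).add
      (hasSum_geometric_of_norm_lt_one h1)).mul_left p
    rw [sub_sub_cancel, show p * ((1 - p) / p ^ 2 + p⁻¹) = p⁻¹ by field_simp; ring] at this
    have h : (fun k : ℕ => (1 - p) ^ k * p * ((k + 1 : ℕ) : ℝ))
        = fun k : ℕ => p * (k * (1 - p) ^ k + (1 - p) ^ k) := by
      ext k; push_cast; ring
    rwa [h]
  rw [mean, geomLaw, lintegral_sum_measure, ← hs.tsum_eq,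
    ENNReal.ofReal_tsum_of_nonneg _ hs.summable]
  · refine tsum_congr fun k => ?_
    rw [lintegral_smul_measure, lintegral_dirac, smul_eq_mul,
      ENNReal.ofReal_mul (q := ((k + 1 : ℕ) : ℝ)) (by have := hp.1; positivity),
      ENNReal.ofReal_natCast]
  · intro k; have := hp.1; positivity

/-- The tail `(1 - p) ^ k` divided by the mean `1 / p` is the geometric mass, so the residual
initial sojourn is distributed like a full one. -/
lemma residualLaw_geomLaw (hp : p ∈ Set.Ioo (0 : ℝ) 1) :
    residualLaw (geomLaw p) = geomLaw p := by
  rw [residualLaw, mean_geomLaw hp]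
  conv_rhs => rw [geomLaw]
  congr 1
  ext1 k
  rw [geomLaw_tail hp, ← ENNReal.ofReal_div_of_pos (inv_pos.2 hp.1), div_inv_eq_mul]

end Geometric

/-! ### One edge as a two-state Markov chain -/

variable {p q : ℝ}

lemma rho_mem (hp : p ∈ Set.Ioo (0 : ℝ) 1) (hq : q ∈ Set.Ioo (0 : ℝ) 1) :
    rho p q ∈ Set.Ioo (0 : ℝ) 1 := by
  have := hp.1; have := hq.1
  exact ⟨by unfold rho; positivity, by unfold rho; rw [div_lt_one (by positivity)]; linarith⟩

lemma onProb_geomLaw (hp : p ∈ Set.Ioo (0 : ℝ) 1) (hq : q ∈ Set.Ioo (0 : ℝ) 1) :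
    onProb (geomLaw p) (geomLaw q) = ENNReal.ofReal (rho p q) := by
  have := hp.1; have := hq.1
  rw [onProb, mean_geomLaw hp, mean_geomLaw hq,
    ← ENNReal.ofReal_add (by positivity) (by positivity),
    ← ENNReal.ofReal_div_of_pos (by positivity), rho]
  congr 1
  field_simp
  ring

/-- The Bernoulli weight of a truth value. -/
def bern (r : ℝ) (b : Bool) : ℝ := if b then r else 1 - r

/-- The probability that an edge in the given state is on one time unit later. -/
def upProb (p q : ℝ) (b : Bool) : ℝ := if b then 1 - p else q

/-- The law of a sojourn in the given state. -/
noncomputable def sojournLaw (p q : ℝ) (b : Bool) : Measure ℕ :=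
  if b then geomLaw p else geomLaw q

/-- The law of the data of one edge with a given state at time `1`. -/
noncomputable def startLaw (p q : ℝ) (b : Bool) : Measure EdgeData :=
  ((Measure.dirac b).prod (sojournLaw p q b)).prod
    ((Measure.infinitePi fun _ : ℕ => geomLaw p).prod (Measure.infinitePi fun _ : ℕ => geomLaw q))

lemma isProbabilityMeasure_sojournLaw (hp : p ∈ Set.Ioo (0 : ℝ) 1) (hq : q ∈ Set.Ioo (0 : ℝ) 1)
    (b : Bool) : IsProbabilityMeasure (sojournLaw p q b) := by
  cases b
  · exact isProbabilityMeasure_geomLaw hq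
  · exact isProbabilityMeasure_geomLaw hp

lemma isProbabilityMeasure_startLaw (hp : p ∈ Set.Ioo (0 : ℝ) 1) (hq : q ∈ Set.Ioo (0 : ℝ) 1)
    (b : Bool) : IsProbabilityMeasure (startLaw p q b) := by
  have := isProbabilityMeasure_geomLaw hp
  have := isProbabilityMeasure_geomLaw hq
  have := isProbabilityMeasure_sojournLaw hp hq b
  unfold startLaw
  infer_instance

lemma edgeLaw_geomLaw (hp : p ∈ Set.Ioo (0 : ℝ) 1) (hq : q ∈ Set.Ioo (0 : ℝ) 1) :
    edgeLaw (geomLaw p) (geomLaw q)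
      = ∑ b, ENNReal.ofReal (bern (rho p q) b) • startLaw p q b := by
  have := isProbabilityMeasure_geomLaw hp
  have := isProbabilityMeasure_geomLaw hq
  have hr := rho_mem hp hq
  rw [edgeLaw, initLaw, onProb_geomLaw hp hq, residualLaw_geomLaw hp, residualLaw_geomLaw hq,
    ← ENNReal.ofReal_one, ← ENNReal.ofReal_sub _ hr.1.le, Measure.add_prod,
    Measure.prod_smul_left, Measure.prod_smul_left, Fintype.sum_bool]
  rfl

/-- The data of the edge as seen one time unit later. -/
def step (e : EdgeData) : EdgeData :=
  if e.1.2 ≤ 1 then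
    if e.1.1 then ((false, e.2.2 0), e.2.1, fun i => e.2.2 (i + 1))
    else ((true, e.2.1 0), (fun i => e.2.1 (i + 1)), e.2.2)
  else ((e.1.1, e.1.2 - 1), e.2)

lemma measurable_step : Measurable step := by
  unfold step
  refine Measurable.ite (measurableSet_le (by fun_prop) (by fun_prop)) (Measurable.ite ?_ ?_ ?_) ?_
  · exact measurableSet_eq_fun (by fun_prop) (by fun_prop)
  · refine Measurable.prodMk (Measurable.prodMk (by fun_prop) ?_) (Measurable.prodMk ?_ ?_)
    · fun_prop
    · fun_prop
    · exact measurable_pi_lambda _ fun i => (measurable_pi_apply _).comp (by fun_prop)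
  · refine Measurable.prodMk (Measurable.prodMk (by fun_prop) ?_) (Measurable.prodMk ?_ ?_)
    · fun_prop
    · exact measurable_pi_lambda _ fun i => (measurable_pi_apply _).comp (by fun_prop)
    · fun_prop
  · refine Measurable.prodMk (Measurable.prodMk (by fun_prop) ?_) (by fun_prop)
    exact (measurable_of_countable (fun m : ℕ => m - 1)).comp (by fun_prop)

/-- A residual duration `1` means that the state flips now and the new sojourn is the head of the
sequence of the opposite state; `infinitePi_eq_map_seqCons` makes it fresh. -/
lemma map_step_dirac_one (hp : p ∈ Set.Ioo (0 : ℝ) 1) (hq : q ∈ Set.Ioo (0 : ℝ) 1) (b : Bool) :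
    (((Measure.dirac b).prod (Measure.dirac 1)).prod
      ((Measure.infinitePi fun _ : ℕ => geomLaw p).prod
        (Measure.infinitePi fun _ : ℕ => geomLaw q))).map step = startLaw p q (!b) := by
  have := isProbabilityMeasure_geomLaw hp
  have := isProbabilityMeasure_geomLaw hq
  refine Measure.ext_of_lintegral _ fun F hF => ?_
  rw [lintegral_map hF measurable_step, Measure.dirac_prod_dirac,
    lintegral_prod (fun e => F (step e)) (hF.comp measurable_step).aemeasurable,
    lintegral_dirac, startLaw,
    lintegral_prod _ hF.aemeasurable, Measure.dirac_prod, lintegral_map (by fun_prop) (by fun_prop)]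
  cases b
  · simp only [Bool.not_false, sojournLaw, if_true]
    conv_lhs => rw [infinitePi_eq_map_seqCons (geomLaw p)]
    rw [lintegral_prod _ (by have := measurable_step; fun_prop),
      lintegral_map (by have := measurable_step; fun_prop) measurable_seqCons,
      lintegral_prod _ (by have := measurable_step; have := measurable_seqCons; fun_prop)]
    refine lintegral_congr fun a => ?_
    rw [lintegral_prod _ (by fun_prop)]
    rfl
  · simp only [Bool.not_true, sojournLaw]
    conv_lhs => rw [infinitePi_eq_map_seqCons (geomLaw q)]
    rw [lintegral_prod _ (by have := measurable_step; fun_prop)]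
    have h1 : ∀ x, ∫⁻ y, F (step ((true, 1), (x, y)))
          ∂((geomLaw q).prod (Measure.infinitePi fun _ : ℕ => geomLaw q)).map seqCons
        = ∫⁻ a, ∫⁻ y, F ((false, a), x, y) ∂(Measure.infinitePi fun _ : ℕ => geomLaw q)
          ∂geomLaw q := by
      intro x
      rw [lintegral_map (by have := measurable_step; fun_prop) measurable_seqCons,
        lintegral_prod _ (by have := measurable_step; have := measurable_seqCons; fun_prop)]
      rfl
    simp_rw [h1]
    -- The off-sequence is the inner factor of the product, while its head has to become the
    -- outermost variable.
    rw [lintegral_lintegral_swap (by fun_prop)]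
    refine lintegral_congr fun a => ?_
    rw [lintegral_prod _ (by fun_prop)]

/-- Durations are almost surely positive, so one more than a duration is at least `2`: `step` takes
its last branch and undoes the increment. -/
lemma map_step_succ (hp : p ∈ Set.Ioo (0 : ℝ) 1) (hq : q ∈ Set.Ioo (0 : ℝ) 1) (b : Bool) :
    (((Measure.dirac b).prod ((sojournLaw p q b).map (· + 1))).prod
      ((Measure.infinitePi fun _ : ℕ => geomLaw p).prod
        (Measure.infinitePi fun _ : ℕ => geomLaw q))).map step = startLaw p q b := by
  have := isProbabilityMeasure_geomLaw hp
  have := isProbabilityMeasure_geomLaw hq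
  have := isProbabilityMeasure_sojournLaw hp hq b
  have : SFinite ((sojournLaw p q b).map (· + 1)) := inferInstance
  have hpos : ∀ᵐ l ∂sojournLaw p q b, 1 ≤ l := by cases b <;> exact ae_geomLaw_pos _
  have := measurable_step
  refine Measure.ext_of_lintegral _ fun F hF => ?_
  rw [lintegral_map hF measurable_step, startLaw, lintegral_prod _ hF.aemeasurable,
    lintegral_prod (fun e => F (step e)) (hF.comp measurable_step).aemeasurable,
    Measure.dirac_prod, Measure.dirac_prod,
    lintegral_map (by fun_prop) (by fun_prop), lintegral_map (by fun_prop) (by fun_prop),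
    lintegral_map (by fun_prop) (by fun_prop)]
  refine lintegral_congr_ae ?_
  filter_upwards [hpos] with l hl
  refine lintegral_congr fun r => ?_
  congr 1
  simp only [step]
  rw [if_neg (by omega)]
  simp

lemma sojournLaw_eq_add (hp : p ∈ Set.Ioo (0 : ℝ) 1) (hq : q ∈ Set.Ioo (0 : ℝ) 1) (b : Bool) :
    sojournLaw p q b = ENNReal.ofReal (bern (upProb p q b) (!b)) • Measure.dirac 1
      + ENNReal.ofReal (bern (upProb p q b) b) • (sojournLaw p q b).map (· + 1) := by
  cases b
  · exact geomLaw_eq_add hq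
  · simpa [bern, upProb, sojournLaw] using geomLaw_eq_add hp

/-- One time step of an edge is a transition of a two-state Markov chain. -/
lemma map_step_startLaw (hp : p ∈ Set.Ioo (0 : ℝ) 1) (hq : q ∈ Set.Ioo (0 : ℝ) 1) (b : Bool) :
    (startLaw p q b).map step
      = ∑ c, ENNReal.ofReal (bern (upProb p q b) c) • startLaw p q c := by
  have := isProbabilityMeasure_geomLaw hp
  have := isProbabilityMeasure_geomLaw hq
  have := isProbabilityMeasure_sojournLaw hp hq b
  have hs : SFinite ((sojournLaw p q b).map (· + 1)) := inferInstance
  have h : startLaw p q b = _ := rfl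
  rw [h]
  conv_lhs => rw [startLaw, sojournLaw_eq_add hp hq b]
  rw [Measure.prod_add, Measure.prod_smul_right, Measure.prod_smul_right, Measure.add_prod,
    Measure.prod_smul_left, Measure.prod_smul_left, Measure.map_add _ _ measurable_step,
    Measure.map_smul, Measure.map_smul, map_step_dirac_one hp hq, map_step_succ hp hq]
  cases b
  · rw [Fintype.sum_bool]; rfl
  · rw [Fintype.sum_bool, add_comm]; rfl

/-! ### The on-indicator along the time shift -/

/-- All durations are positive. -/
def Good (e : EdgeData) : Prop := 1 ≤ e.1.2 ∧ (∀ i, 1 ≤ e.2.1 i) ∧ ∀ i, 1 ≤ e.2.2 i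

lemma ae_infinitePi_pos (hp : p ∈ Set.Ioo (0 : ℝ) 1) :
    ∀ᵐ x ∂Measure.infinitePi (fun _ : ℕ => geomLaw p), ∀ i, 1 ≤ x i := by
  have := isProbabilityMeasure_geomLaw hp
  refine ae_all_iff.2 fun i => ?_
  exact (measurePreserving_eval_infinitePi (fun _ : ℕ => geomLaw p) i).quasiMeasurePreserving.ae
    (ae_geomLaw_pos p)

lemma ae_good_startLaw (hp : p ∈ Set.Ioo (0 : ℝ) 1) (hq : q ∈ Set.Ioo (0 : ℝ) 1) (b : Bool) :
    ∀ᵐ e ∂startLaw p q b, Good e ∧ e.1.1 = b := by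
  have := isProbabilityMeasure_geomLaw hp
  have := isProbabilityMeasure_geomLaw hq
  have := isProbabilityMeasure_sojournLaw hp hq b
  have hpos : ∀ᵐ l ∂sojournLaw p q b, 1 ≤ l := by cases b <;> exact ae_geomLaw_pos _
  have h1 : ∀ᵐ e ∂startLaw p q b, e.1.2 ≥ 1 :=
    (Measure.quasiMeasurePreserving_snd.comp Measure.quasiMeasurePreserving_fst).ae hpos
  have h2 : ∀ᵐ e ∂startLaw p q b, ∀ i, e.2.1 i ≥ 1 :=
    (Measure.quasiMeasurePreserving_fst.comp Measure.quasiMeasurePreserving_snd).ae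
      (ae_infinitePi_pos hp)
  have h3 : ∀ᵐ e ∂startLaw p q b, ∀ i, e.2.2 i ≥ 1 :=
    (Measure.quasiMeasurePreserving_snd.comp Measure.quasiMeasurePreserving_snd).ae
      (ae_infinitePi_pos hq)
  have h4 : ∀ᵐ e ∂startLaw p q b, e.1.1 = b :=
    (Measure.quasiMeasurePreserving_fst.comp Measure.quasiMeasurePreserving_fst).ae
      (p := fun c => c = b) ((ae_dirac_iff .of_discrete).2 rfl)
  filter_upwards [h1, h2, h3, h4] with e a1 a2 a3 a4
  exact ⟨⟨a1, a2, a3⟩, a4⟩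

lemma phase_eq (e : EdgeData) (m : ℕ) : phase e m = if m % 2 = 0 then e.1.1 else !e.1.1 := by
  induction m with
  | zero => rfl
  | succ m ih =>
    rw [phase, ih]
    rcases Nat.mod_two_eq_zero_or_one m with h | h
    · rw [if_pos h, if_neg (by omega)]
    · rw [if_neg (by omega), if_pos (by omega), Bool.not_not]

lemma elapsed_succ' (e : EdgeData) (m : ℕ) :
    elapsed e (m + 1) = e.1.2 + ∑ i ∈ Finset.range m, sojourn e (i + 1) := by
  rw [elapsed, Finset.sum_range_succ', add_comm]
  rfl

lemma isOn_succ_iff_of_two_le {e : EdgeData} (he : 2 ≤ e.1.2) {k : ℕ} (hk : 1 ≤ k) :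
    IsOn e (k + 1) ↔ IsOn (step e) k := by
  have hs : step e = ((e.1.1, e.1.2 - 1), e.2) := by rw [step, if_neg (by omega)]
  have h1 : ∀ m, phase (step e) m = phase e m := fun m => by rw [phase_eq, phase_eq, hs]
  have h2 : ∀ m, sojourn (step e) (m + 1) = sojourn e (m + 1) := fun m => by
    rw [sojourn, sojourn, h1, hs]
  have h3 : ∀ m, elapsed e (m + 1) = elapsed (step e) (m + 1) + 1 := fun m => by
    simp_rw [elapsed_succ', h2]
    rw [hs]
    dsimp only
    omega
  have h4 : ∀ e', elapsed e' 0 = 0 := fun _ => rfl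
  unfold IsOn
  refine exists_congr fun m => ?_
  rw [h1, h3]
  cases m with
  -- The left end of the first sojourn is `0` both before and after the shift; this is where `1 ≤ k`
  -- enters.
  | zero => rw [h4, h4]; refine and_congr_right fun _ => ?_; omega
  | succ m => rw [h3]; refine and_congr_right fun _ => ?_; omega

/-- `step` deletes the head of the sequence that sojourn `1` uses. Sojourns of that type have their
index `m / 2` lowered by one, and those of the other type keep it; parity of `m` separates the two
cases. -/
lemma sojourn_step {e : EdgeData} (he : e.1.2 = 1) (m : ℕ) :
    sojourn (step e) m = sojourn e (m + 1) := by
  obtain ⟨⟨b, r⟩, x, y⟩ := e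
  obtain rfl : r = 1 := he
  cases m with
  | zero => cases b <;> simp [sojourn, step, phase_eq]
  | succ m =>
    rw [sojourn, sojourn, phase_eq, phase_eq]
    rcases Nat.mod_two_eq_zero_or_one m with h | h
    · have h1 : (m + 1) % 2 = 1 := by omega
      have h2 : (m + 1 + 1) % 2 = 0 := by omega
      have h3 : (m + 1) / 2 = m / 2 := by omega
      cases b <;> simp [step, h1, h2, h3]
    · have h1 : (m + 1) % 2 = 0 := by omega
      have h2 : (m + 1 + 1) % 2 = 1 := by omega
      have h3 : (m + 1) / 2 = m / 2 + 1 := by omega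
      cases b <;> simp [step, h1, h2, h3]

lemma isOn_succ_iff_of_eq_one {e : EdgeData} (he : e.1.2 = 1) {k : ℕ} (hk : 1 ≤ k) :
    IsOn e (k + 1) ↔ IsOn (step e) k := by
  have h1 : ∀ m, phase (step e) m = phase e (m + 1) := fun m => by
    rw [phase_eq, phase_eq]
    have h0 : (step e).1.1 = !e.1.1 := by
      rw [step, if_pos (by omega)]
      cases e.1.1 <;> simp
    rw [h0]
    rcases Nat.mod_two_eq_zero_or_one m with h | h
    · rw [if_pos h, if_neg (by omega)]
    · rw [if_neg (by omega), if_pos (by omega), Bool.not_not]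
  have h3 : ∀ m, elapsed e (m + 1) = elapsed (step e) m + 1 := fun m => by
    rw [elapsed_succ', elapsed, he, add_comm]
    simp_rw [sojourn_step he]
  unfold IsOn
  constructor
  · rintro ⟨m, hm⟩
    cases m with
    -- Sojourn `0` of `e` ends at time `1`, so it cannot contain `k + 1`.
    | zero =>
      have := h3 0
      rw [this] at hm
      have h4 : elapsed (step e) 0 = 0 := rfl
      omega
    | succ m =>
      refine ⟨m, ?_⟩
      rw [h1]
      rw [h3, h3] at hm
      exact ⟨hm.1, by omega, by omega⟩
  · rintro ⟨m, hm⟩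
    refine ⟨m + 1, ?_⟩
    rw [h3, h3, ← h1]
    exact ⟨hm.1, by omega, by omega⟩

lemma isOn_one_iff {e : EdgeData} (he : 1 ≤ e.1.2) : IsOn e 1 ↔ e.1.1 = true := by
  constructor
  · rintro ⟨m, hm⟩
    cases m with
    | zero => exact hm.1
    | succ m =>
      rw [elapsed_succ'] at hm
      omega
  · intro h
    exact ⟨0, h, by simp [elapsed], by rw [elapsed_succ']; simpa using he⟩

lemma Good.step {e : EdgeData} (he : Good e) : Good (step e) := by
  obtain ⟨⟨b, r⟩, x, y⟩ := e
  obtain ⟨h1, h2, h3⟩ := he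
  rw [OnOff.step]
  dsimp only at h1 h2 h3 ⊢
  split_ifs with h h'
  · exact ⟨h3 0, h2, fun i => h3 _⟩
  · exact ⟨h2 0, fun i => h2 _, h3⟩
  · exact ⟨by dsimp only; omega, h2, h3⟩

/-- The state of an edge at time `k + 1` is the initial state of the data after `k` steps. -/
lemma isOn_succ_iff {e : EdgeData} (he : Good e) (k : ℕ) :
    IsOn e (k + 1) ↔ (step^[k] e).1.1 = true := by
  induction k generalizing e with
  | zero => exact isOn_one_iff he.1
  | succ k ih =>
    rw [Function.iterate_succ_apply, ← ih he.step]
    rcases he.1.eq_or_lt with h | h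
    · exact isOn_succ_iff_of_eq_one h.symm (by omega)
    · exact isOn_succ_iff_of_two_le h (by omega)

lemma onInd_succ {e : EdgeData} (he : Good e) (k : ℕ) :
    onInd e (k + 1) = if (step^[k] e).1.1 then 1 else 0 := by
  classical
  rw [onInd]
  exact if_congr (isOn_succ_iff he k) rfl rfl

/-! ### Finite Markov chains realized by a shift -/

lemma integrable_comp_of_finite {E S V : Type*} [MeasurableSpace E] [MeasurableSpace S] [Finite S]
    [DiscreteMeasurableSpace S] [NormedAddCommGroup V] {ν : Measure E} [IsFiniteMeasure ν]
    {Y : E → S} (hY : Measurable Y) (g : S → V) : Integrable (fun e => g (Y e)) ν :=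
  (Integrable.of_finite (μ := ν.map Y) (f := g)).comp_measurable hY

/-- Under `μ x`, the states `X, X ∘ T, X ∘ T ∘ T, …` form a Markov chain that starts at `x` and has
the transition probabilities `Q`. -/
structure IsMarkovShift {E S : Type*} [MeasurableSpace E] [MeasurableSpace S] [Fintype S]
    (T : E → E) (X : E → S) (μ : S → Measure E) (Q : S → S → ℝ) : Prop where
  prob : ∀ x, IsProbabilityMeasure (μ x)
  measurable_shift : Measurable T
  measurable_state : Measurable X
  start : ∀ x, ∀ᵐ e ∂μ x, X e = x
  nonneg : ∀ x y, 0 ≤ Q x y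
  map_shift : ∀ x, (μ x).map T = ∑ y, ENNReal.ofReal (Q x y) • μ y

/-- The mixture of finitely many measures with the given weights. -/
noncomputable def mixture {E S : Type*} [MeasurableSpace E] [Fintype S] (π : S → ℝ)
    (μ : S → Measure E) : Measure E :=
  ∑ x, ENNReal.ofReal (π x) • μ x

lemma integrable_mixture {E S V : Type*} [MeasurableSpace E] [Fintype S] [NormedAddCommGroup V]
    {π : S → ℝ} {μ : S → Measure E} {F : E → V} (hF : ∀ x, Integrable F (μ x)) :
    Integrable F (mixture π μ) :=
  integrable_finsetSum_measure.2 fun x _ => (hF x).smul_measure ENNReal.ofReal_ne_top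

lemma integral_mixture {E S V : Type*} [MeasurableSpace E] [Fintype S] [NormedAddCommGroup V]
    [NormedSpace ℝ V] {π : S → ℝ} (hπ : ∀ x, 0 ≤ π x) {μ : S → Measure E} {F : E → V}
    (hF : ∀ x, Integrable F (μ x)) :
    ∫ e, F e ∂mixture π μ = ∑ x, π x • ∫ e, F e ∂μ x := by
  rw [mixture, integral_finsetSum_measure fun x _ => (hF x).smul_measure ENNReal.ofReal_ne_top]
  refine Finset.sum_congr rfl fun x _ => ?_
  rw [integral_smul_measure, ENNReal.toReal_ofReal (hπ x)]

namespace IsMarkovShift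

variable {E S : Type*} [MeasurableSpace E] [MeasurableSpace S] [Fintype S]
  {T : E → E} {X : E → S} {μ : S → Measure E} {Q : S → S → ℝ}

lemma measurable_iterate (h : IsMarkovShift T X μ Q) (k : ℕ) :
    Measurable fun e => X (T^[k] e) :=
  h.measurable_state.comp (h.measurable_shift.iterate k)

lemma sum_eq_one (h : IsMarkovShift T X μ Q) (x : S) : ∑ y, Q x y = 1 := by
  have := h.prob
  have h1 := congrArg (fun m => m Set.univ) (h.map_shift x)
  simp only [Measure.map_apply h.measurable_shift .univ, Set.preimage_univ, measure_univ,
    Measure.coe_finsetSum, Finset.sum_apply, Measure.smul_apply, smul_eq_mul, mul_one] at h1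
  rw [← ENNReal.ofReal_sum_of_nonneg fun y _ => h.nonneg x y] at h1
  simpa using h1.symm

lemma integral_shift (h : IsMarkovShift T X μ Q) {V : Type*} [NormedAddCommGroup V]
    [NormedSpace ℝ V] {F : E → V} (hF : ∀ y, Integrable F (μ y)) (x : S) :
    ∫ e, F (T e) ∂μ x = ∑ y, Q x y • ∫ e, F e ∂μ y := by
  have h1 := integrable_mixture (π := Q x) hF
  have h2 : (μ x).map T = mixture (Q x) μ := h.map_shift x
  rw [← integral_map h.measurable_shift.aemeasurable (h2 ▸ h1.aestronglyMeasurable), h2,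
    integral_mixture (h.nonneg x) hF]

variable {π : S → ℝ}

lemma map_shift_mixture (h : IsMarkovShift T X μ Q) (hπ : ∀ x, 0 ≤ π x)
    (hst : ∀ y, ∑ x, π x * Q x y = π y) : (mixture π μ).map T = mixture π μ := by
  ext s hs
  rw [Measure.map_apply h.measurable_shift hs]
  simp only [mixture, Measure.coe_finsetSum, Finset.sum_apply, Measure.smul_apply, smul_eq_mul]
  simp_rw [← Measure.map_apply h.measurable_shift hs, h.map_shift]
  simp only [Measure.coe_finsetSum, Finset.sum_apply, Measure.smul_apply, smul_eq_mul,
    Finset.mul_sum, ← mul_assoc]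
  rw [Finset.sum_comm]
  refine Finset.sum_congr rfl fun y _ => ?_
  rw [← Finset.sum_mul]
  congr 1
  rw [← hst y, ENNReal.ofReal_sum_of_nonneg fun x _ => mul_nonneg (hπ x) (h.nonneg x y)]
  exact Finset.sum_congr rfl fun x _ => (ENNReal.ofReal_mul (hπ x)).symm

lemma integral_iterate_mixture (h : IsMarkovShift T X μ Q) (hπ : ∀ x, 0 ≤ π x)
    (hst : ∀ y, ∑ x, π x * Q x y = π y) {F : E → ℝ} (hF : ∀ y, Integrable F (μ y)) (j : ℕ) :
    ∫ e, F (T^[j] e) ∂mixture π μ = ∫ e, F e ∂mixture π μ := by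
  have h1 : MeasurePreserving T^[j] (mixture π μ) (mixture π μ) :=
    MeasurePreserving.iterate ⟨h.measurable_shift, h.map_shift_mixture hπ hst⟩ j
  rw [← integral_map h1.measurable.aemeasurable
    (h1.map_eq.symm ▸ (integrable_mixture hF).aestronglyMeasurable), h1.map_eq]

variable {𝕜 : Type*} [RCLike 𝕜]

/-- The Markov property in the form used throughout: under `μ x` the first state is `x`, and after
the shift the law is a mixture of the `μ y`, under each of which the next state is `y`. -/
lemma integral_mul_shift (h : IsMarkovShift T X μ Q) {F : E → 𝕜}
    (hF : ∀ y, Integrable F (μ y)) (w : S → S → 𝕜) (x : S) :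
    ∫ e, w (X e) (X (T e)) * F (T e) ∂μ x = ∑ y, (Q x y : 𝕜) * (w x y * ∫ e, F e ∂μ y) := by
  have h1 : ∫ e, w (X e) (X (T e)) * F (T e) ∂μ x = ∫ e, w x (X (T e)) * F (T e) ∂μ x :=
    integral_congr_ae ((h.start x).mono fun e he => by simp only [he])
  have h2 : ∀ y, (fun e => w x (X e) * F e) =ᵐ[μ y] fun e => w x y * F e := fun y =>
    (h.start y).mono fun e he => by simp only [he]
  rw [h1, h.integral_shift (F := fun e => w x (X e) * F e)
    fun y => ((hF y).const_mul _).congr (h2 y).symm]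
  refine Finset.sum_congr rfl fun y _ => ?_
  rw [integral_congr_ae (h2 y), integral_const_mul, RCLike.real_smul_eq_coe_mul]

lemma integral_pair (h : IsMarkovShift T X μ Q) (w : S → S → 𝕜) (x : S) :
    ∫ e, w (X e) (X (T e)) ∂μ x = ∑ y, (Q x y : 𝕜) * w x y := by
  have := h.prob
  simpa using h.integral_mul_shift (F := fun _ => (1 : 𝕜)) (fun y => integrable_const _) w x

variable [DiscreteMeasurableSpace S]

/-- The expectation of a product along the path is an entry of the power of a transfer operator. -/
lemma integral_prod_path (h : IsMarkovShift T X μ Q) (w : S → S → 𝕜)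
    (L : (S → 𝕜) →ₗ[𝕜] (S → 𝕜)) (hL : ∀ v x, L v x = ∑ y, (Q x y : 𝕜) * (w x y * v y))
    (N : ℕ) (x : S) :
    (∀ y, Integrable (fun e => ∏ k ∈ Finset.range N, w (X (T^[k] e)) (X (T^[k + 1] e))) (μ y)) ∧
    ∫ e, ∏ k ∈ Finset.range N, w (X (T^[k] e)) (X (T^[k + 1] e)) ∂μ x
      = (L ^ N) (fun _ => 1) x := by
  have := h.prob
  induction N generalizing x with
  | zero => simp
  | succ N ih =>
    refine ⟨fun y => ?_, ?_⟩
    -- The integrand depends on the first `N + 2` states only, which take finitely many values.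
    · have hm : Measurable fun e => fun k : Fin (N + 2) => X (T^[k] e) :=
        measurable_pi_lambda _ fun k => h.measurable_iterate k
      convert integrable_comp_of_finite (ν := μ y) hm
        (fun s => ∏ k : Fin (N + 1), w (s k.castSucc) (s k.succ)) using 2 with e
      rw [Finset.prod_range]
      rfl
    -- The first factor is split off, not the last one: the remaining product is the shorter product
    -- evaluated at `T e`.
    · simp_rw [Finset.prod_range_succ', mul_comm _ (w (X (T^[0] _)) _)]
      rw [pow_succ', Module.End.mul_apply, hL]
      simp_rw [← (ih _).2]
      exact h.integral_mul_shift (fun y => (ih y).1 y) w x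

lemma integrable_pair (h : IsMarkovShift T X μ Q) (w : S → S → 𝕜) (k l : ℕ) (x : S) :
    Integrable (fun e => w (X (T^[k] e)) (X (T^[l] e))) (μ x) := by
  have := h.prob
  exact integrable_comp_of_finite ((h.measurable_iterate k).prodMk (h.measurable_iterate l))
    fun s => w s.1 s.2

variable {d : S → S → ℝ} {φ ψ : S → ℝ} {α β c lam kap : ℝ}

/-- If the mean of `d` over one transition is a combination of two eigenfunctions and a constant,
then its mean after `k` transitions is explicit. -/
lemma integral_pair_iterate (h : IsMarkovShift T X μ Q)
    (hd : ∀ x, ∑ y, Q x y * d x y = α * φ x + β * ψ x + c)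
    (hφ : ∀ x, ∑ y, Q x y * φ y = lam * φ x) (hψ : ∀ x, ∑ y, Q x y * ψ y = kap * ψ x)
    (k : ℕ) (x : S) :
    ∫ e, d (X (T^[k] e)) (X (T^[k + 1] e)) ∂μ x
      = α * lam ^ k * φ x + β * kap ^ k * ψ x + c := by
  induction k generalizing x with
  | zero => simpa [hd] using h.integral_pair d x
  | succ k ih =>
    have h1 := h.integral_shift (F := fun e => d (X (T^[k] e)) (X (T^[k + 1] e)))
      (fun y => h.integrable_pair d k (k + 1) y) x
    simp_rw [ih, smul_eq_mul] at h1
    simp_rw [Function.iterate_succ_apply] at h1 ⊢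
    rw [h1]
    have h2 : ∀ y, Q x y * (α * lam ^ k * φ y + β * kap ^ k * ψ y + c)
        = α * lam ^ k * (Q x y * φ y) + β * kap ^ k * (Q x y * ψ y) + c * Q x y := fun y => by ring
    simp_rw [h2, Finset.sum_add_distrib, ← Finset.mul_sum, hφ, hψ, h.sum_eq_one]
    ring

lemma integral_pair_mul_pair (h : IsMarkovShift T X μ Q) (D : S → S → ℝ)
    (hd : ∀ x, ∑ y, Q x y * d x y = α * φ x + β * ψ x + c)
    (hφ : ∀ x, ∑ y, Q x y * φ y = lam * φ x) (hψ : ∀ x, ∑ y, Q x y * ψ y = kap * ψ x)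
    (k : ℕ) (x : S) :
    ∫ e, D (X e) (X (T e)) * d (X (T^[k + 1] e)) (X (T^[k + 2] e)) ∂μ x
      = ∑ y, Q x y * (D x y * (α * lam ^ k * φ y + β * kap ^ k * ψ y + c)) := by
  have h1 := h.integral_mul_shift (F := fun e => d (X (T^[k] e)) (X (T^[k + 1] e)))
    (fun y => h.integrable_pair d k (k + 1) y) D x
  simp_rw [h.integral_pair_iterate hd hφ hψ] at h1
  exact h1

end IsMarkovShift

/-! ### Finitely many independent edges -/

section Product

variable {n : ℕ}

/-- The product Bernoulli weights. -/
def bernProd (r : Fin n → ℝ) (y : Fin n → Bool) : ℝ := ∏ j, bern (r j) (y j)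

/-- The transition probabilities of the states of `n` independent edges. -/
def trans (p q : ℝ) (x y : Fin n → Bool) : ℝ := bernProd (fun j => upProb p q (x j)) y

/-- The stationary probabilities of the states of `n` independent edges. -/
noncomputable def stat (p q : ℝ) (x : Fin n → Bool) : ℝ := bernProd (fun _ => rho p q) x

/-- The states of the edges at time `1`. -/
def states (e : Fin n → EdgeData) (j : Fin n) : Bool := (e j).1.1

/-- The data of the edges as seen one time unit later. -/
def stepAll (e : Fin n → EdgeData) (j : Fin n) : EdgeData := step (e j)

/-- The law of the data of `n` independent edges with given states at time `1`. -/
noncomputable def startAll (p q : ℝ) (x : Fin n → Bool) : Measure (Fin n → EdgeData) :=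
  Measure.pi fun j => startLaw p q (x j)

lemma stepAll_iterate (e : Fin n → EdgeData) (k : ℕ) (j : Fin n) :
    (stepAll^[k] e) j = step^[k] (e j) := by
  induction k generalizing e with
  | zero => rfl
  | succ k ih => rw [Function.iterate_succ_apply, ih, Function.iterate_succ_apply]; rfl

lemma bern_pos {r : ℝ} (hr : r ∈ Set.Ioo (0 : ℝ) 1) (b : Bool) : 0 < bern r b := by
  cases b
  · simpa [bern] using hr.2
  · simpa [bern] using hr.1

lemma bernProd_pos {r : Fin n → ℝ} (hr : ∀ j, r j ∈ Set.Ioo (0 : ℝ) 1) (y : Fin n → Bool) :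
    0 < bernProd r y :=
  Finset.prod_pos fun j _ => bern_pos (hr j) _

/-- A product of two-point mixtures expands into a mixture of products. It serves twice: for the
stationary law, with all weights equal to `rho p q`, and for one transition, with weights depending
on the current states. -/
lemma pi_sum_bern (ν : Bool → Measure EdgeData) [∀ b, IsProbabilityMeasure (ν b)] {r : Fin n → ℝ}
    (hr : ∀ j, r j ∈ Set.Ioo (0 : ℝ) 1) :
    Measure.pi (fun j => ∑ b, ENNReal.ofReal (bern (r j) b) • ν b)
      = mixture (bernProd r) fun y => Measure.pi fun j => ν (y j) := by
  have : ∀ j, IsFiniteMeasure (∑ b, ENNReal.ofReal (bern (r j) b) • ν b) := fun j => by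
    have : ∀ b, IsFiniteMeasure (ENNReal.ofReal (bern (r j) b) • ν b) := fun b =>
      Measure.smul_finite _ ENNReal.ofReal_ne_top
    infer_instance
  refine Measure.pi_eq fun s hs => ?_
  simp only [mixture, Measure.coe_finsetSum, Finset.sum_apply, Measure.smul_apply, smul_eq_mul,
    Measure.pi_pi]
  rw [Finset.prod_univ_sum, Fintype.piFinset_univ]
  refine Finset.sum_congr rfl fun y _ => ?_
  rw [Finset.prod_mul_distrib, bernProd,
    ENNReal.ofReal_prod_of_nonneg fun j _ => (bern_pos (hr j) _).le]

variable {p q : ℝ}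

lemma upProb_mem (hp : p ∈ Set.Ioo (0 : ℝ) 1) (hq : q ∈ Set.Ioo (0 : ℝ) 1) (b : Bool) :
    upProb p q b ∈ Set.Ioo (0 : ℝ) 1 := by
  cases b
  · exact hq
  · exact ⟨sub_pos.2 hp.2, by simpa [upProb] using hp.1⟩

lemma trans_pos (hp : p ∈ Set.Ioo (0 : ℝ) 1) (hq : q ∈ Set.Ioo (0 : ℝ) 1) (x y : Fin n → Bool) :
    0 < trans p q x y :=
  bernProd_pos (fun _ => upProb_mem hp hq _) y

lemma stat_pos (hp : p ∈ Set.Ioo (0 : ℝ) 1) (hq : q ∈ Set.Ioo (0 : ℝ) 1) (x : Fin n → Bool) :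
    0 < stat p q x :=
  bernProd_pos (fun _ => rho_mem hp hq) x

/-- The sum factorizes over the edges, which leaves the balance equation of the two-state chain. -/
lemma sum_stat_mul_trans (hp : p ∈ Set.Ioo (0 : ℝ) 1) (hq : q ∈ Set.Ioo (0 : ℝ) 1)
    (y : Fin n → Bool) : ∑ x, stat p q x * trans p q x y = stat p q y := by
  simp only [stat, trans, bernProd, ← Finset.prod_mul_distrib]
  rw [← Fintype.piFinset_univ, ← Finset.prod_univ_sum (t := fun _ => Finset.univ)
    (f := fun j b => bern (rho p q) b * bern (upProb p q b) (y j))]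
  refine Finset.prod_congr rfl fun j _ => ?_
  have h : p + q ≠ 0 := by linarith [hp.1, hq.1]
  rw [Fintype.sum_bool]
  cases y j <;> simp only [bern, upProb, rho, if_true, Bool.false_eq_true, if_false] <;>
    field_simp <;> ring

lemma sum_bernProd (r : Fin n → ℝ) : ∑ y, bernProd r y = 1 := by
  simp only [bernProd]
  rw [← Fintype.piFinset_univ, ← Finset.prod_univ_sum (t := fun _ => Finset.univ)
    (f := fun j b => bern (r j) b)]
  exact Finset.prod_eq_one fun j _ => by simp [bern]

lemma isMarkovShift (hp : p ∈ Set.Ioo (0 : ℝ) 1) (hq : q ∈ Set.Ioo (0 : ℝ) 1) :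
    IsMarkovShift (stepAll (n := n)) states (startAll p q) (trans p q) := by
  have hprob := isProbabilityMeasure_startLaw hp hq
  refine ⟨fun x => ?_, ?_, ?_, fun x => ?_, fun x y => (trans_pos hp hq x y).le, fun x => ?_⟩
  · unfold startAll; infer_instance
  · exact measurable_pi_lambda _ fun j => measurable_step.comp (measurable_pi_apply j)
  · exact measurable_pi_lambda _ fun j => by
      exact measurable_fst.comp (measurable_fst.comp (measurable_pi_apply j))
  · have h1 : ∀ j, ∀ᵐ e ∂startAll p q x, (e j).1.1 = x j := fun j =>
      (measurePreserving_eval (fun j => startLaw p q (x j)) j).quasiMeasurePreserving.ae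
        ((ae_good_startLaw hp hq (x j)).mono fun e he => he.2)
    filter_upwards [ae_all_iff.2 h1] with e he
    exact funext he
  · have h1 : (startAll p q x).map stepAll = Measure.pi fun j => (startLaw p q (x j)).map step := by
      have : ∀ j, SigmaFinite ((startLaw p q (x j)).map step) := fun j => by
        have := Measure.isProbabilityMeasure_map (μ := startLaw p q (x j))
          measurable_step.aemeasurable
        infer_instance
      exact Measure.pi_map_pi (fun j => measurable_step.aemeasurable)
    rw [h1]
    simp_rw [map_step_startLaw hp hq]
    exact pi_sum_bern (startLaw p q) fun j => upProb_mem hp hq (x j)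

lemma pi_edgeLaw (hp : p ∈ Set.Ioo (0 : ℝ) 1) (hq : q ∈ Set.Ioo (0 : ℝ) 1) :
    Measure.pi (fun _ : Fin n => edgeLaw (geomLaw p) (geomLaw q))
      = mixture (stat p q) (startAll p q) := by
  have hprob := isProbabilityMeasure_startLaw hp hq
  simp_rw [edgeLaw_geomLaw hp hq]
  exact pi_sum_bern (startLaw p q) fun _ => rho_mem hp hq

lemma ae_good_startAll (hp : p ∈ Set.Ioo (0 : ℝ) 1) (hq : q ∈ Set.Ioo (0 : ℝ) 1)
    (x : Fin n → Bool) : ∀ᵐ e ∂startAll p q x, ∀ j, Good (e j) := by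
  have hprob := isProbabilityMeasure_startLaw hp hq
  exact ae_all_iff.2 fun j =>
    (measurePreserving_eval (fun j => startLaw p q (x j)) j).quasiMeasurePreserving.ae
      ((ae_good_startLaw hp hq (x j)).mono fun e he => he.1)

/-- The number of edges that are on. -/
def onCount (x : Fin n → Bool) : ℝ := ∑ j, if x j then 1 else 0

lemma sum_onInd_succ {e : Fin n → EdgeData} (he : ∀ j, Good (e j)) (k : ℕ) :
    ∑ j, onInd (e j) (k + 1) = onCount (states (stepAll^[k] e)) := by
  refine Finset.sum_congr rfl fun j _ => ?_
  rw [onInd_succ (he j), states, stepAll_iterate]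

end Product

/-! ### Transfer operators and the central limit theorem -/

section Transfer

open Asymptotics

variable {S : Type*} [Fintype S]

/-- The transfer operator of the transition probabilities `Q` with the multiplicative weight `w`. -/
def transfer (Q : S → S → ℝ) (w : S → S → ℂ) : (S → ℂ) →ₗ[ℂ] (S → ℂ) where
  toFun v x := ∑ y, (Q x y : ℂ) * (w x y * v y)
  map_add' v v' := by
    ext x
    simp only [Pi.add_apply, mul_add, Finset.sum_add_distrib]
  map_smul' c v := by
    ext x
    simp only [Pi.smul_apply, smul_eq_mul, RingHom.id_apply, Finset.mul_sum]
    exact Finset.sum_congr rfl fun y _ => by ring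

lemma transfer_apply (Q : S → S → ℝ) (w : S → S → ℂ) (v : S → ℂ) (x : S) :
    transfer Q w v x = ∑ y, (Q x y : ℂ) * (w x y * v y) := rfl

variable {Q : S → S → ℝ}

lemma norm_transfer_le (hQ : ∀ x y, 0 ≤ Q x y) (hQ1 : ∀ x, ∑ y, Q x y = 1) {w : S → S → ℂ}
    (hw : ∀ x y, ‖w x y‖ ≤ 1) (v : S → ℂ) : ‖transfer Q w v‖ ≤ ‖v‖ := by
  refine (pi_norm_le_iff_of_nonneg (norm_nonneg v)).2 fun x => ?_
  calc ‖transfer Q w v x‖ ≤ ∑ y, ‖(Q x y : ℂ) * (w x y * v y)‖ := norm_sum_le _ _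
    _ ≤ ∑ y, Q x y * ‖v‖ := by
        refine Finset.sum_le_sum fun y _ => ?_
        rw [norm_mul, norm_mul, Complex.norm_real, Real.norm_of_nonneg (hQ x y)]
        refine mul_le_mul_of_nonneg_left ?_ (hQ x y)
        calc ‖w x y‖ * ‖v y‖ ≤ 1 * ‖v‖ :=
              mul_le_mul (hw x y) (norm_le_pi_norm v y) (norm_nonneg _) zero_le_one
          _ = ‖v‖ := one_mul _
    _ = ‖v‖ := by rw [← Finset.sum_mul, hQ1, one_mul]

lemma norm_pow_le_of_norm_le {V : Type*} [SeminormedAddCommGroup V] [Module ℂ V] {L : V →ₗ[ℂ] V}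
    (hL : ∀ v, ‖L v‖ ≤ ‖v‖) (N : ℕ) (v : V) : ‖(L ^ N) v‖ ≤ ‖v‖ := by
  induction N with
  | zero => simp
  | succ N ih => rw [pow_succ', Module.End.mul_apply]; exact (hL _).trans ih

/-- Telescoping: both `L` and multiplication by `lam` are contractions, so the one-step error is
never amplified and accumulates at most linearly. -/
lemma norm_pow_sub_smul_le {V : Type*} [SeminormedAddCommGroup V] [NormedSpace ℂ V]
    {L : V →ₗ[ℂ] V} (hL : ∀ v, ‖L v‖ ≤ ‖v‖) {lam : ℂ} (hlam : ‖lam‖ ≤ 1) (N : ℕ) (v : V) :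
    ‖(L ^ N) v - lam ^ N • v‖ ≤ N * ‖L v - lam • v‖ := by
  induction N with
  | zero => simp
  | succ N ih =>
    have h : (L ^ (N + 1)) v - lam ^ (N + 1) • v
        = L ((L ^ N) v - lam ^ N • v) + lam ^ N • (L v - lam • v) := by
      rw [pow_succ', Module.End.mul_apply, map_sub, map_smul, smul_sub, smul_smul, pow_succ]
      abel
    rw [h]
    refine (norm_add_le _ _).trans ?_
    have h1 : ‖lam ^ N • (L v - lam • v)‖ ≤ ‖L v - lam • v‖ := by
      rw [norm_smul, norm_pow]
      exact mul_le_of_le_one_left (norm_nonneg _) (pow_le_one₀ (norm_nonneg _) hlam)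
    have h2 := (hL ((L ^ N) v - lam ^ N • v)).trans ih
    push_cast
    linarith

/-- A function that is invariant under strictly positive transition probabilities is constant. -/
lemma eq_of_sum_mul_eq (hQ : ∀ x y, 0 < Q x y) (hQ1 : ∀ x, ∑ y, Q x y = 1) {u : S → ℝ}
    (hu : ∀ x, ∑ y, Q x y * u y = u x) (x y : S) : u x = u y := by
  have : Nonempty S := ⟨x⟩
  obtain ⟨m, hm⟩ := Finite.exists_max u
  -- Maximum principle: at a maximum point of `u` a positively weighted sum of nonnegative
  -- differences vanishes, hence every difference does.
  have h1 : ∑ y, Q m y * (u m - u y) = 0 := by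
    simp_rw [mul_sub, Finset.sum_sub_distrib, ← Finset.sum_mul, hQ1, hu]
    ring
  have h2 : ∀ y, u y = u m := fun y => by
    have := (Finset.sum_eq_zero_iff_of_nonneg fun y _ =>
      mul_nonneg (hQ m y).le (sub_nonneg.2 (hm y))).1 h1 y (Finset.mem_univ y)
    have := (mul_eq_zero.1 this).resolve_left (hQ m y).ne'
    linarith
  rw [h2 x, h2 y]

/-- The Poisson equation of a Markov chain with strictly positive transition probabilities. -/
lemma exists_poisson (hQ : ∀ x y, 0 < Q x y) (hQ1 : ∀ x, ∑ y, Q x y = 1) {π : S → ℝ}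
    (hπ : ∑ x, π x = 1) (hst : ∀ y, ∑ x, π x * Q x y = π y) {g : S → ℝ}
    (hg : ∑ x, π x * g x = 0) : ∃ u : S → ℝ, ∀ x, u x - ∑ y, Q x y * u y = g x := by
  have hst' : ∀ u : S → ℝ, ∑ x, π x * ∑ y, Q x y * u y = ∑ y, π y * u y := fun u => by
    simp_rw [Finset.mul_sum, ← mul_assoc]
    rw [Finset.sum_comm]
    simp_rw [← Finset.sum_mul, hst]
  -- The operator `1 - Q` kills constants. Adding the stationary mean repairs this, and in finite
  -- dimension injectivity then yields surjectivity.
  let B : (S → ℝ) →ₗ[ℝ] (S → ℝ) :=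
    { toFun := fun u x => u x - ∑ y, Q x y * u y + ∑ y, π y * u y
      map_add' := fun u v => by
        ext x
        simp only [Pi.add_apply, mul_add, Finset.sum_add_distrib]
        ring
      map_smul' := fun c u => by
        ext x
        simp only [Pi.smul_apply, smul_eq_mul, RingHom.id_apply, mul_left_comm _ c,
          ← Finset.mul_sum]
        ring }
  have hB : ∀ u x, B u x = u x - ∑ y, Q x y * u y + ∑ y, π y * u y := fun _ _ => rfl
  -- `B` preserves the stationary mean, so the preimage of a centred function is centred and the
  -- added term vanishes on it.
  have hmean : ∀ u, ∑ x, π x * B u x = ∑ x, π x * u x := fun u => by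
    simp_rw [hB, mul_add, mul_sub, Finset.sum_add_distrib, Finset.sum_sub_distrib, hst',
      ← Finset.sum_mul, hπ]
    ring
  have hinj : Function.Injective B := by
    refine (injective_iff_map_eq_zero B).2 fun u hu => ?_
    have h0 : ∑ x, π x * u x = 0 := by rw [← hmean, hu]; simp
    have h1 : ∀ x, ∑ y, Q x y * u y = u x := fun x => by
      have := congrFun hu x
      rw [hB, h0] at this
      simp only [Pi.zero_apply] at this
      linarith
    ext x
    have h2 : ∀ y, u y = u x := fun y => eq_of_sum_mul_eq hQ hQ1 h1 y x
    simp_rw [h2, ← Finset.sum_mul, hπ, one_mul] at h0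
    exact h0
  obtain ⟨u, hu⟩ := LinearMap.injective_iff_surjective.1 hinj g
  refine ⟨u, fun x => ?_⟩
  have h0 : ∑ x, π x * u x = 0 := by rw [← hmean, hu, hg]
  rw [← hu, hB, h0, add_zero]

/-- The second-order expansion of an approximate eigenvector of the transfer operator. -/
lemma transfer_expansion_isBigO (hQ1 : ∀ x, ∑ y, Q x y = 1) {d : S → S → ℝ} {u v : S → ℝ}
    {s : ℝ} (hu : ∀ x, u x - ∑ y, Q x y * u y = ∑ y, Q x y * d x y)
    (hv : ∀ x, v x - ∑ y, Q x y * v y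
      = s / 2 - ∑ y, Q x y * (d x y * u y) - (∑ y, Q x y * d x y ^ 2) / 2) (x : S) :
    (fun θ : ℝ => transfer Q (fun x y => Complex.exp (θ * d x y * Complex.I))
        (fun y => 1 + θ * u y * Complex.I + θ ^ 2 * v y) x
      - (1 - θ ^ 2 * s / 2) * (1 + θ * u x * Complex.I + θ ^ 2 * v x))
      =O[𝓝 0] fun θ : ℝ => θ ^ 3 := by
  have hE : ∀ y, (fun θ : ℝ => Complex.exp (θ * d x y * Complex.I)
      - (1 + θ * d x y * Complex.I - (θ * d x y) ^ 2 / 2)) =O[𝓝 0] fun θ : ℝ => θ ^ 3 := fun y => by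
    have hc : Tendsto (fun θ : ℝ => (θ : ℂ) * d x y * Complex.I) (𝓝 0) (𝓝 0) := by
      have : Continuous fun θ : ℝ => (θ : ℂ) * d x y * Complex.I := by fun_prop
      simpa using this.tendsto 0
    have h1 := (Complex.exp_sub_sum_range_isBigO_pow 3).comp_tendsto hc
    have h2 : (fun θ : ℝ => ((θ : ℂ) * d x y * Complex.I) ^ 3) =O[𝓝 0] fun θ : ℝ => θ ^ 3 := by
      refine IsBigO.of_bound (|d x y| ^ 3) (Eventually.of_forall fun θ => ?_)
      simp only [norm_mul, norm_pow, Complex.norm_real, Complex.norm_I, Real.norm_eq_abs, mul_one]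
      rw [mul_pow, mul_comm]
    refine (h1.trans h2).congr_left fun θ => ?_
    simp only [Function.comp_apply, Finset.sum_range_succ, Finset.sum_range_zero, Nat.factorial]
    push_cast
    have := Complex.I_sq
    linear_combination (-(θ : ℂ) ^ 2 * d x y ^ 2 / 2) * this
  have hU : ∀ y, (fun θ : ℝ => (1 : ℂ) + θ * u y * Complex.I + θ ^ 2 * v y)
      =O[𝓝 0] fun _ : ℝ => (1 : ℝ) := fun y => by
    have : Continuous fun θ : ℝ => (1 : ℂ) + θ * u y * Complex.I + θ ^ 2 * v y := by fun_prop
    exact (this.tendsto 0).isBigO_one ℝ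
  -- The terms of order at least three that are left when the second-order polynomials are
  -- multiplied out.
  have hP : (fun θ : ℝ => (θ : ℂ) ^ 3 * (∑ y, (Q x y : ℂ) * (d x y * v y * Complex.I
        - d x y ^ 2 * u y * Complex.I / 2 - θ * d x y ^ 2 * v y / 2)
      + s * u x * Complex.I / 2 + θ * s * v x / 2)) =O[𝓝 0] fun θ : ℝ => θ ^ 3 := by
    have hc : Continuous fun θ : ℝ => ∑ y, (Q x y : ℂ) * (d x y * v y * Complex.I
        - d x y ^ 2 * u y * Complex.I / 2 - θ * d x y ^ 2 * v y / 2)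
      + s * u x * Complex.I / 2 + θ * s * v x / 2 := by fun_prop
    have h1 := (hc.tendsto 0).isBigO_one ℝ
    have h2 : (fun θ : ℝ => (θ : ℂ) ^ 3) =O[𝓝 0] fun θ : ℝ => θ ^ 3 :=
      IsBigO.of_bound 1 (Eventually.of_forall fun θ => by simp)
    simpa using h2.mul h1
  have hsum : (fun θ : ℝ => ∑ y, (Q x y : ℂ) * ((Complex.exp (θ * d x y * Complex.I)
      - (1 + θ * d x y * Complex.I - (θ * d x y) ^ 2 / 2))
        * (1 + θ * u y * Complex.I + θ ^ 2 * v y))) =O[𝓝 0] fun θ : ℝ => θ ^ 3 := by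
    exact IsBigO.fun_sum fun y _ =>
      ((((hE y).mul (hU y)).const_mul_left (Q x y : ℂ)).congr_right fun θ => mul_one _)
  refine (hsum.add hP).congr_left fun θ => ?_
  have e1 : ∑ y, (Q x y : ℂ) = 1 := by exact_mod_cast hQ1 x
  have e2 : (u x : ℂ) - ∑ y, (Q x y : ℂ) * u y = ∑ y, (Q x y : ℂ) * d x y := by
    exact_mod_cast hu x
  have e3 : (v x : ℂ) - ∑ y, (Q x y : ℂ) * v y
      = s / 2 - ∑ y, (Q x y : ℂ) * (d x y * u y) - (∑ y, (Q x y : ℂ) * d x y ^ 2) / 2 := by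
    exact_mod_cast hv x
  rw [transfer_apply]
  have e4 : ∀ y, (Q x y : ℂ) * (Complex.exp (θ * d x y * Complex.I)
        * (1 + θ * u y * Complex.I + θ ^ 2 * v y))
      = (Q x y : ℂ) * ((Complex.exp (θ * d x y * Complex.I)
      - (1 + θ * d x y * Complex.I - (θ * d x y) ^ 2 / 2))
        * (1 + θ * u y * Complex.I + θ ^ 2 * v y)) + Q x y
        + (θ * Complex.I) * ((Q x y : ℂ) * d x y) + (θ * Complex.I) * ((Q x y : ℂ) * u y)
        + (θ : ℂ) ^ 2 * ((Q x y : ℂ) * v y) - (θ : ℂ) ^ 2 * ((Q x y : ℂ) * (d x y * u y))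
        - ((θ : ℂ) ^ 2 / 2) * ((Q x y : ℂ) * d x y ^ 2)
        + (θ : ℂ) ^ 3 * ((Q x y : ℂ) * (d x y * v y * Complex.I
        - d x y ^ 2 * u y * Complex.I / 2 - θ * d x y ^ 2 * v y / 2)) := fun y => by
    have := Complex.I_sq
    linear_combination (Q x y : ℂ) * (θ : ℂ) ^ 2 * d x y * u y * this
  simp_rw [e4, Finset.sum_add_distrib, Finset.sum_sub_distrib, Finset.sum_add_distrib,
    ← Finset.mul_sum]
  -- The orders `0`, `1` and `2` in `θ` cancel by `hQ1`, `hu` and `hv` respectively.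
  linear_combination -e1 + (θ : ℂ) * Complex.I * e2 + (θ : ℂ) ^ 2 * e3

lemma tendsto_inv_sqrt_natCast : Tendsto (fun N : ℕ => (√(N : ℝ))⁻¹) atTop (𝓝 0) :=
  tendsto_inv_atTop_zero.comp (Real.tendsto_sqrt_atTop.comp tendsto_natCast_atTop_atTop)

/-- The central limit theorem for additive functionals of a finite Markov chain with strictly
positive transition probabilities, in terms of transfer operators. -/
theorem tendsto_transfer_pow (hQ : ∀ x y, 0 < Q x y) (hQ1 : ∀ x, ∑ y, Q x y = 1) {π : S → ℝ}
    (hπ : ∑ x, π x = 1) (hst : ∀ y, ∑ x, π x * Q x y = π y) {d : S → S → ℝ} {u : S → ℝ}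
    (hu : ∀ x, u x - ∑ y, Q x y * u y = ∑ y, Q x y * d x y) {s : ℝ} (hs0 : 0 ≤ s)
    (hs : s = ∑ x, π x * ∑ y, Q x y * (d x y ^ 2 + 2 * d x y * u y)) :
    Tendsto (fun N : ℕ => (transfer Q
        (fun x y => Complex.exp ((√(N : ℝ))⁻¹ * d x y * Complex.I)) ^ N) fun _ => 1)
      atTop (𝓝 fun _ => Complex.exp (-s / 2)) := by
  -- The second-order corrector exists because the value of `s` is exactly the one that gives the
  -- right-hand side stationary mean zero.
  obtain ⟨v, hv⟩ := exists_poisson hQ hQ1 hπ hst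
    (g := fun x => s / 2 - ∑ y, Q x y * (d x y * u y) - (∑ y, Q x y * d x y ^ 2) / 2) (by
      have h1 : ∀ x, π x * ∑ y, Q x y * (d x y ^ 2 + 2 * d x y * u y)
          = π x * (∑ y, Q x y * d x y ^ 2) + 2 * (π x * ∑ y, Q x y * (d x y * u y)) := fun x => by
        rw [mul_left_comm 2, ← mul_add, Finset.mul_sum _ _ 2, ← Finset.sum_add_distrib]
        congr 1
        exact Finset.sum_congr rfl fun y _ => by ring
      simp_rw [h1, Finset.sum_add_distrib, ← Finset.mul_sum] at hs
      simp_rw [mul_sub, Finset.sum_sub_distrib, ← Finset.sum_mul, hπ, mul_div_assoc',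
        ← Finset.sum_div]
      linarith)
  have hexp : ∀ (θ : ℝ) (x y : S), ‖Complex.exp (θ * d x y * Complex.I)‖ ≤ 1 := fun θ x y => by
    rw [← Complex.ofReal_mul, Complex.norm_exp_ofReal_mul_I]
  let L : ℝ → (S → ℂ) →ₗ[ℂ] (S → ℂ) := fun θ =>
    transfer Q (fun x y => Complex.exp (θ * d x y * Complex.I))
  have hL : ∀ θ w, ‖L θ w‖ ≤ ‖w‖ := fun θ w =>
    norm_transfer_le (fun x y => (hQ x y).le) hQ1 (hexp θ) w
  let U : ℝ → S → ℂ := fun θ y => 1 + θ * u y * Complex.I + θ ^ 2 * v y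
  let lam : ℝ → ℂ := fun θ => 1 - θ ^ 2 * s / 2
  let θ : ℕ → ℝ := fun N => (√(N : ℝ))⁻¹
  have hθ : Tendsto θ atTop (𝓝 0) := tendsto_inv_sqrt_natCast
  have hθ2 : ∀ N : ℕ, θ N ^ 2 = (N : ℝ)⁻¹ := fun N => by
    simp only [θ]; rw [inv_pow, Real.sq_sqrt (Nat.cast_nonneg N)]
  have hR : (fun t => L t (U t) - lam t • U t) =O[𝓝 0] fun t : ℝ => t ^ 3 :=
    isBigO_pi.2 fun x => transfer_expansion_isBigO hQ1 hu hv x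
  have hUt : Tendsto (fun N => U (θ N)) atTop (𝓝 fun _ => 1) := by
    have : Continuous U := by fun_prop
    have h1 := (this.tendsto 0).comp hθ
    have h2 : U 0 = fun _ => 1 := by ext y; simp [U]
    rwa [h2] at h1
  have hlam : Tendsto (fun N : ℕ => lam (θ N) ^ N) atTop (𝓝 (Complex.exp (-s / 2))) := by
    refine (Complex.tendsto_one_add_div_pow_exp (-s / 2)).congr fun N => ?_
    have : ((θ N : ℝ) : ℂ) ^ 2 = (N : ℂ)⁻¹ := by
      rw [← Complex.ofReal_pow, hθ2, Complex.ofReal_inv, Complex.ofReal_natCast]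
    simp only [lam, this]
    congr 1
    ring
  -- The bound `lam ≤ 1` uses `0 ≤ s`; the bound `-1 ≤ lam` holds once `θ` is small.
  have hlam1 : ∀ᶠ N in atTop, ‖lam (θ N)‖ ≤ 1 := by
    have h1 : Tendsto (fun N => θ N ^ 2 * s / 2) atTop (𝓝 0) := by
      simpa using ((hθ.pow 2).mul_const s).div_const 2
    filter_upwards [h1.eventually (gt_mem_nhds (show (0 : ℝ) < 2 by norm_num))] with N hN
    have h2 : lam (θ N) = ((1 - θ N ^ 2 * s / 2 : ℝ) : ℂ) := by simp [lam]
    rw [h2, Complex.norm_real, Real.norm_eq_abs, abs_le]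
    constructor
    · linarith
    · have : 0 ≤ θ N ^ 2 * s / 2 := by positivity
      linarith
  have h2 : Tendsto (fun N : ℕ => (L (θ N) ^ N) (U (θ N)) - lam (θ N) ^ N • U (θ N)) atTop
      (𝓝 0) := by
    -- `N` errors of size `O(θ³)` with `θ² = 1 / N` amount to `O(θ)`.
    have h3 : Tendsto (fun N : ℕ => (N : ℝ) * ‖L (θ N) (U (θ N)) - lam (θ N) • U (θ N)‖) atTop
        (𝓝 0) := by
      have h4 := (isBigO_refl (fun N : ℕ => (N : ℝ)) atTop).mul (hR.comp_tendsto hθ).norm_left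
      refine h4.trans_tendsto (hθ.congr fun N => ?_)
      simp only [Function.comp_apply]
      rw [pow_succ, hθ2, ← mul_assoc]
      rcases Nat.eq_zero_or_pos N with rfl | hN
      · simp [θ]
      · rw [mul_inv_cancel₀ (by positivity), one_mul]
    refine squeeze_zero_norm' ?_ h3
    filter_upwards [hlam1] with N hN
    exact norm_pow_sub_smul_le (hL _) hN N _
  -- The constant `1` may replace the approximate eigenvector, since the powers are contractions and
  -- `U (θ N)` tends to `1`.
  have h3 : Tendsto (fun N : ℕ => (L (θ N) ^ N) ((fun _ => 1) - U (θ N))) atTop (𝓝 0) := by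
    refine squeeze_zero_norm (fun N => norm_pow_le_of_norm_le (hL _) N _) ?_
    simpa using ((tendsto_const_nhds (x := fun _ : S => (1 : ℂ))).sub hUt).norm
  have h4 := ((hlam.smul hUt).add h2).add h3
  have h5 : (Complex.exp (-s / 2) • (fun _ : S => (1 : ℂ))) + 0 + 0
      = fun _ => Complex.exp (-s / 2) := by ext; simp
  rw [h5] at h4
  refine h4.congr fun N => ?_
  rw [map_sub]
  simp only [L, θ]
  push_cast
  abel

end Transfer

/-! ### Moments and eigenfunctions of the number of edges that are on -/

section Moments

variable {n : ℕ}

/-- Conditioning on the first edge; the moments below follow by induction on the number of edges.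
The parameters may differ between edges because the transition probabilities depend on the current
states. -/
lemma sum_bernProd_succ_mul (r : Fin (n + 1) → ℝ) (F : (Fin (n + 1) → Bool) → ℝ) :
    ∑ y, bernProd r y * F y = r 0 * ∑ y, bernProd (fun j => r j.succ) y * F (Fin.cons true y)
      + (1 - r 0) * ∑ y, bernProd (fun j => r j.succ) y * F (Fin.cons false y) := by
  rw [← (Fin.consEquiv fun _ : Fin (n + 1) => Bool).sum_comp, Fintype.sum_prod_type,
    Fintype.sum_bool]
  simp only [Fin.consEquiv_apply, bernProd, Fin.prod_univ_succ, Fin.cons_zero, Fin.cons_succ, bern,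
    if_true, Bool.false_eq_true, if_false, mul_assoc, Finset.mul_sum]
  rfl

lemma onCount_cons (b : Bool) (y : Fin n → Bool) :
    onCount (Fin.cons b y : Fin (n + 1) → Bool) = (if b then 1 else 0) + onCount y := by
  simp only [onCount, Fin.sum_univ_succ, Fin.cons_zero, Fin.cons_succ]

lemma sum_bernProd_onCount (r : Fin n → ℝ) : ∑ y, bernProd r y * onCount y = ∑ j, r j := by
  induction n with
  | zero => simp [onCount]
  | succ n ih =>
    rw [sum_bernProd_succ_mul]
    simp only [onCount_cons, if_true, Bool.false_eq_true, if_false, zero_add, mul_add, mul_one,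
      Finset.sum_add_distrib, ih, sum_bernProd, Fin.sum_univ_succ]
    ring

lemma sum_bernProd_onCount_sq (r : Fin n → ℝ) :
    ∑ y, bernProd r y * onCount y ^ 2 = (∑ j, r j) ^ 2 + ∑ j, r j * (1 - r j) := by
  induction n with
  | zero => simp [onCount]
  | succ n ih =>
    rw [sum_bernProd_succ_mul]
    have h : ∀ y : Fin n → Bool, bernProd (fun j => r j.succ) y * (1 + onCount y) ^ 2
        = bernProd (fun j => r j.succ) y + 2 * (bernProd (fun j => r j.succ) y * onCount y)
          + bernProd (fun j => r j.succ) y * onCount y ^ 2 := fun y => by ring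
    simp only [onCount_cons, if_true, Bool.false_eq_true, if_false, zero_add, h,
      Finset.sum_add_distrib, ← Finset.mul_sum, ih, sum_bernProd, sum_bernProd_onCount,
      Fin.sum_univ_succ]
    ring

/-- Cumulants of independent summands add up, and the third moment is `κ₁³ + 3κ₁κ₂ + κ₃`. -/
lemma sum_bernProd_onCount_cube (r : Fin n → ℝ) :
    ∑ y, bernProd r y * onCount y ^ 3
      = (∑ j, r j) ^ 3 + 3 * (∑ j, r j) * (∑ j, r j * (1 - r j))
        + ∑ j, r j * (1 - r j) * (1 - 2 * r j) := by
  induction n with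
  | zero => simp [onCount]
  | succ n ih =>
    rw [sum_bernProd_succ_mul]
    have h : ∀ y : Fin n → Bool, bernProd (fun j => r j.succ) y * (1 + onCount y) ^ 3
        = bernProd (fun j => r j.succ) y + 3 * (bernProd (fun j => r j.succ) y * onCount y)
          + 3 * (bernProd (fun j => r j.succ) y * onCount y ^ 2)
          + bernProd (fun j => r j.succ) y * onCount y ^ 3 := fun y => by ring
    simp only [onCount_cons, if_true, Bool.false_eq_true, if_false, zero_add, h,
      Finset.sum_add_distrib, ← Finset.mul_sum, ih, sum_bernProd, sum_bernProd_onCount,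
      sum_bernProd_onCount_sq, Fin.sum_univ_succ]
    ring

/-- The cumulants of the next count are such sums, so its conditional moments are polynomials in the
current count alone. -/
lemma sum_comp_state (g : Bool → ℝ) (x : Fin n → Bool) :
    ∑ j, g (x j) = g true * onCount x + g false * (n - onCount x) := by
  have h : ∀ j, g (x j) = (g true - g false) * (if x j then 1 else 0) + g false := fun j => by
    cases x j <;> simp
  simp_rw [h, Finset.sum_add_distrib, ← Finset.mul_sum]
  rw [onCount, Finset.sum_const, Finset.card_univ, Fintype.card_fin, nsmul_eq_mul]
  ring

/-- States correspond to subsets of edges, which are grouped by cardinality. -/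
lemma sum_stat_comp_onCount (p q : ℝ) (G : ℝ → ℝ) :
    ∑ x : Fin n → Bool, stat p q x * G (onCount x)
      = ∑ a ∈ Finset.range (n + 1),
        (n.choose a : ℝ) * rho p q ^ a * (1 - rho p q) ^ (n - a) * G a := by
  have hcount : ∀ x : Fin n → Bool,
      onCount x = ((Finset.univ.filter fun j => x j = true).card : ℝ) := fun x => by
    simp [onCount, Finset.sum_boole]
  have hstat : ∀ x : Fin n → Bool, stat p q x
      = rho p q ^ (Finset.univ.filter fun j => x j = true).card
        * (1 - rho p q) ^ (n - (Finset.univ.filter fun j => x j = true).card) := fun x => by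
    have h1 : (Finset.univ.filter fun j => ¬ x j = true).card
        = n - (Finset.univ.filter fun j => x j = true).card := by
      rw [← Finset.compl_filter, Finset.card_compl, Fintype.card_fin]
    rw [stat, bernProd]
    simp only [bern]
    rw [Finset.prod_ite, Finset.prod_const, Finset.prod_const, h1]
  have hbij : Function.Bijective fun x : Fin n → Bool => Finset.univ.filter fun j => x j = true := by
    refine ⟨fun x y h => funext fun j => ?_, fun s => ⟨fun j => decide (j ∈ s), by ext; simp⟩⟩
    have := congrArg (j ∈ ·) h
    simpa using this
  rw [Fintype.sum_bijective _ hbij _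
    (fun s : Finset (Fin n) => rho p q ^ s.card * (1 - rho p q) ^ (n - s.card) * G s.card)
    fun x => by rw [hstat, hcount], ← Finset.powerset_univ,
    Finset.sum_powerset_apply_card
      (fun a => rho p q ^ a * (1 - rho p q) ^ (n - a) * G (a : ℝ)),
    Finset.card_univ, Fintype.card_fin]
  refine Finset.sum_congr rfl fun a _ => ?_
  rw [nsmul_eq_mul]
  ring

variable {p q : ℝ}

lemma sum_stat_onCount_pow (p q : ℝ) (i : ℕ) :
    ∑ x : Fin n → Bool, stat p q x * onCount x ^ i = binMoment n p q i :=
  sum_stat_comp_onCount p q fun a => a ^ i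

lemma binMoment_one (n : ℕ) (p q : ℝ) : binMoment n p q 1 = n * rho p q := by
  rw [← sum_stat_onCount_pow]
  simpa [stat] using sum_bernProd_onCount (n := n) fun _ => rho p q

lemma binMoment_two (n : ℕ) (p q : ℝ) :
    binMoment n p q 2 = (n * rho p q) ^ 2 + n * (rho p q * (1 - rho p q)) := by
  rw [← sum_stat_onCount_pow]
  simpa [stat] using sum_bernProd_onCount_sq (n := n) fun _ => rho p q

lemma sum_trans (x : Fin n → Bool) : ∑ y, trans p q x y = 1 := sum_bernProd _

lemma sum_stat (n : ℕ) (p q : ℝ) : ∑ x : Fin n → Bool, stat p q x = 1 := sum_bernProd _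

lemma sum_trans_onCount (x : Fin n → Bool) :
    ∑ y, trans p q x y * onCount y = ff p q * onCount x + n * q := by
  have h := sum_bernProd_onCount fun j => upProb p q (x j)
  rw [sum_comp_state (upProb p q)] at h
  rw [show ∑ y, trans p q x y * onCount y = _ from h]
  simp only [upProb, ff, if_true, Bool.false_eq_true, if_false]
  ring

lemma sum_trans_onCount_sq (x : Fin n → Bool) :
    ∑ y, trans p q x y * onCount y ^ 2
      = ff p q ^ 2 * onCount x ^ 2 + ff p q * (p - q + 2 * n * q) * onCount x
        + (n * q * (1 - q) + n ^ 2 * q ^ 2) := by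
  have h := sum_bernProd_onCount_sq fun j => upProb p q (x j)
  rw [sum_comp_state (upProb p q),
    sum_comp_state fun b => upProb p q b * (1 - upProb p q b)] at h
  rw [show ∑ y, trans p q x y * onCount y ^ 2 = _ from h]
  simp only [upProb, ff, if_true, Bool.false_eq_true, if_false]
  ring

lemma sum_trans_onCount_cube (x : Fin n → Bool) :
    ∑ y, trans p q x y * onCount y ^ 3
      = ff p q ^ 3 * onCount x ^ 3 + 3 * ff p q ^ 2 * (p - q + n * q) * onCount x ^ 2
        + ff p q * (3 * n ^ 2 * q ^ 2 + 3 * n * p * q - 6 * n * q ^ 2 + 3 * n * q + 2 * p ^ 2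
        - 2 * p * q - p + 2 * q ^ 2 - q) * onCount x
        + (n * (n - 1) * (n - 2) * q ^ 3 + 3 * n * (n - 1) * q ^ 2 + n * q) := by
  have h := sum_bernProd_onCount_cube fun j => upProb p q (x j)
  rw [sum_comp_state (upProb p q),
    sum_comp_state fun b => upProb p q b * (1 - upProb p q b),
    sum_comp_state fun b => upProb p q b * (1 - upProb p q b) * (1 - 2 * upProb p q b)] at h
  rw [show ∑ y, trans p q x y * onCount y ^ 3 = _ from h]
  simp only [upProb, ff, if_true, Bool.false_eq_true, if_false]
  ring

/-- The mean of a function of two consecutive states of a Markov chain, as a linear functional. -/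
def pairMean {S : Type*} [Fintype S] (π : S → ℝ) (Q : S → S → ℝ) : (S → S → ℝ) →ₗ[ℝ] ℝ where
  toFun D := ∑ x, π x * ∑ y, Q x y * D x y
  map_add' D D' := by
    simp only [Pi.add_apply, mul_add, Finset.sum_add_distrib]
  map_smul' c D := by
    simp only [Pi.smul_apply, smul_eq_mul, RingHom.id_apply, Finset.mul_sum]
    exact Finset.sum_congr rfl fun x _ => Finset.sum_congr rfl fun y _ => by ring

lemma pairMean_apply {S : Type*} [Fintype S] (π : S → ℝ) (Q : S → S → ℝ) (D : S → S → ℝ) :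
    pairMean π Q D = ∑ x, π x * ∑ y, Q x y * D x y := rfl

lemma pairMean_onCount_left (i : ℕ) :
    pairMean (stat p q) (trans p q) (fun x _ : Fin n → Bool => onCount x ^ i)
      = binMoment n p q i := by
  simp_rw [pairMean_apply, ← Finset.sum_mul, sum_trans, one_mul, sum_stat_onCount_pow]

lemma pairMean_mul_one (i : ℕ) :
    pairMean (stat p q) (trans p q) (fun x y : Fin n → Bool => onCount x ^ i * onCount y)
      = ff p q * binMoment n p q (i + 1) + n * q * binMoment n p q i := by
  simp_rw [pairMean_apply, mul_left_comm (trans p q _ _), ← Finset.mul_sum, sum_trans_onCount,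
    ← sum_stat_onCount_pow, Finset.mul_sum, ← Finset.sum_add_distrib]
  exact Finset.sum_congr rfl fun x _ => by ring

lemma pairMean_mul_sq (i : ℕ) :
    pairMean (stat p q) (trans p q) (fun x y : Fin n → Bool => onCount x ^ i * onCount y ^ 2)
      = ff p q ^ 2 * binMoment n p q (i + 2)
        + ff p q * (p - q + 2 * n * q) * binMoment n p q (i + 1)
        + (n * q * (1 - q) + n ^ 2 * q ^ 2) * binMoment n p q i := by
  simp_rw [pairMean_apply, mul_left_comm (trans p q _ _), ← Finset.mul_sum, sum_trans_onCount_sq,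
    ← sum_stat_onCount_pow, Finset.mul_sum, ← Finset.sum_add_distrib]
  exact Finset.sum_congr rfl fun x _ => by ring

lemma pairMean_jointMoment1 :
    pairMean (stat p q) (trans p q) (fun x y : Fin n → Bool => onCount x * onCount y)
      = jointMoment1 n p q := by
  simpa [jointMoment1] using pairMean_mul_one (n := n) (p := p) (q := q) 1

lemma pairMean_jointMoment2 :
    pairMean (stat p q) (trans p q) (fun x y : Fin n → Bool => onCount x * onCount y ^ 2)
      = jointMoment2 n p q := by
  simpa [jointMoment2] using pairMean_mul_sq (n := n) (p := p) (q := q) 1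

lemma pairMean_jointMoment3 :
    pairMean (stat p q) (trans p q) (fun x y : Fin n → Bool => onCount x * onCount y ^ 3)
      = jointMoment3 n p q := by
  simp_rw [pairMean_apply, mul_left_comm (trans p q _ _), ← Finset.mul_sum, sum_trans_onCount_cube,
    jointMoment3, ← sum_stat_onCount_pow, Finset.mul_sum, ← Finset.sum_add_distrib]
  exact Finset.sum_congr rfl fun x _ => by ring

/-- The eigenfunction of the transition probabilities with eigenvalue `f`. -/
noncomputable def eigenLin (p q : ℝ) (x : Fin n → Bool) : ℝ := onCount x - n * rho p q

/-- The eigenfunction of the transition probabilities with eigenvalue `f ^ 2`. -/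
noncomputable def eigenQuad (p q : ℝ) (x : Fin n → Bool) : ℝ :=
  onCount x ^ 2 + (2 * rho p q - 1 - 2 * n * rho p q) * onCount x + n * rho p q ^ 2 * (n - 1)

lemma rho_mul (h : p + q ≠ 0) : rho p q * (1 - ff p q) = q := by
  rw [rho, ff]
  field_simp
  ring

lemma sum_trans_eigenLin (h : p + q ≠ 0) (x : Fin n → Bool) :
    ∑ y, trans p q x y * eigenLin p q y = ff p q * eigenLin p q x := by
  simp only [eigenLin, mul_sub, Finset.sum_sub_distrib, ← Finset.sum_mul, sum_trans,
    sum_trans_onCount]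
  linear_combination -(n : ℝ) * rho_mul h

/-- `eigenQuad` is the sum of `(x_i - ϱ)(x_j - ϱ)` over ordered pairs of distinct edges, with `x_i`
the on-indicator of edge `i`. By independence each such product is multiplied by `f` twice. -/
lemma sum_trans_eigenQuad (h : p + q ≠ 0) (x : Fin n → Bool) :
    ∑ y, trans p q x y * eigenQuad p q y = ff p q ^ 2 * eigenQuad p q x := by
  simp only [eigenQuad, mul_add, Finset.sum_add_distrib, ← Finset.sum_mul, sum_trans,
    mul_left_comm (trans p q _ _), ← Finset.mul_sum, sum_trans_onCount, sum_trans_onCount_sq]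
  simp only [rho, ff]
  field_simp
  ring

/-- The coefficient of `eigenLin` in the conditional mean of `A(k) A(k + 1)`. -/
noncomputable def linCoef (n : ℕ) (p q : ℝ) : ℝ :=
  ff p q - 2 * ff p q * rho p q + n * q + 2 * ff p q * n * rho p q

/-- The conditional mean is `f A² + n q A`, a quadratic polynomial in the count; comparing
coefficients with `eigenQuad` and then `eigenLin` produces `linCoef`. -/
lemma sum_trans_mul (x : Fin n → Bool) :
    ∑ y, trans p q x y * (onCount x * onCount y)
      = linCoef n p q * eigenLin p q x + ff p q * eigenQuad p q x + jointMoment1 n p q := by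
  simp_rw [mul_left_comm (trans p q _ _), ← Finset.mul_sum, sum_trans_onCount]
  rw [jointMoment1, binMoment_one, binMoment_two, eigenLin, eigenQuad, linCoef]
  ring

lemma sum_trans_const (x : Fin n → Bool) :
    ∑ y, trans p q x y * onCount x = 1 * eigenLin p q x + 0 * eigenQuad p q x
      + binMoment n p q 1 := by
  rw [← Finset.sum_mul, sum_trans, binMoment_one, eigenLin]
  ring

lemma pairMean_eigenLin (h : p + q ≠ 0) (i : ℕ) :
    pairMean (stat p q) (trans p q) (fun x y : Fin n → Bool => onCount x ^ i * eigenLin p q y)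
      = ff p q * (binMoment n p q (i + 1) - n * rho p q * binMoment n p q i) := by
  simp_rw [pairMean_apply, mul_left_comm (trans p q _ _), ← Finset.mul_sum, sum_trans_eigenLin h,
    ← sum_stat_onCount_pow, Finset.mul_sum, ← Finset.sum_sub_distrib, Finset.mul_sum]
  exact Finset.sum_congr rfl fun x _ => by rw [eigenLin]; ring

lemma pairMean_eigenQuad (h : p + q ≠ 0) (i : ℕ) :
    pairMean (stat p q) (trans p q) (fun x y : Fin n → Bool => onCount x ^ i * eigenQuad p q y)
      = ff p q ^ 2 * (binMoment n p q (i + 2)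
        + (2 * rho p q - 1 - 2 * n * rho p q) * binMoment n p q (i + 1)
        + n * rho p q ^ 2 * (n - 1) * binMoment n p q i) := by
  simp_rw [pairMean_apply, mul_left_comm (trans p q _ _), ← Finset.mul_sum, sum_trans_eigenQuad h,
    ← sum_stat_onCount_pow, Finset.mul_sum, ← Finset.sum_add_distrib, Finset.mul_sum]
  exact Finset.sum_congr rfl fun x _ => by rw [eigenQuad]; ring

lemma pairMean_mul_eigenLin :
    pairMean (stat p q) (trans p q)
        (fun x y : Fin n → Bool => onCount x * onCount y * eigenLin p q y)
      = jointMoment2 n p q - n * rho p q * jointMoment1 n p q := by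
  rw [← pairMean_jointMoment1, ← pairMean_jointMoment2, ← smul_eq_mul, ← map_smul, ← map_sub]
  congr 1
  ext x y
  simp only [Pi.sub_apply, Pi.smul_apply, smul_eq_mul, eigenLin]
  ring

lemma pairMean_mul_eigenQuad :
    pairMean (stat p q) (trans p q)
        (fun x y : Fin n → Bool => onCount x * onCount y * eigenQuad p q y)
      = jointMoment3 n p q + (2 * rho p q - 1 - 2 * n * rho p q) * jointMoment2 n p q
        + n * rho p q ^ 2 * (n - 1) * jointMoment1 n p q := by
  have h : (fun x y : Fin n → Bool => onCount x * onCount y * eigenQuad p q y)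
      = (fun x y : Fin n → Bool => onCount x * onCount y ^ 3)
        + (2 * rho p q - 1 - 2 * n * rho p q) • (fun x y : Fin n → Bool => onCount x * onCount y ^ 2)
        + (n * rho p q ^ 2 * (n - 1)) • (fun x y : Fin n → Bool => onCount x * onCount y) := by
    ext x y
    simp only [Pi.add_apply, Pi.smul_apply, smul_eq_mul, eigenQuad]
    ring
  rw [h, map_add, map_add, map_smul, map_smul, pairMean_jointMoment1, pairMean_jointMoment2,
    pairMean_jointMoment3, smul_eq_mul, smul_eq_mul]

end Moments

/-! ### Covariances of partial sums of stationary sequences -/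

section Covariance

variable {Ω : Type*} [MeasurableSpace Ω] {P : Measure Ω} [IsFiniteMeasure P]
  {Z Z' : ℕ → Ω → ℝ} {g g' : ℕ → ℝ}

lemma covariance_last_sum (hZ : ∀ k, MemLp (Z k) 2 P) (hZ' : ∀ k, MemLp (Z' k) 2 P)
    (h : ∀ i k, cov[Z' i, Z (i + k); P] = g k) (N : ℕ) :
    cov[Z N, fun ω => ∑ k ∈ Finset.range N, Z' k ω; P] = ∑ k ∈ Finset.range N, g (k + 1) := by
  rw [covariance_fun_sum_right' (fun k _ => hZ' k) (hZ N),
    ← Finset.sum_range_reflect (fun k => g (k + 1))]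
  refine Finset.sum_congr rfl fun k hk => ?_
  have hk := Finset.mem_range.1 hk
  rw [covariance_comm, ← h k]
  congr 2
  omega

/-- Passing from `N` to `N + 1` adds one diagonal term and, for each of the two new summands, its
covariance with the earlier terms of the other sequence. -/
lemma covariance_sum_sum_eq (hZ : ∀ k, MemLp (Z k) 2 P) (hZ' : ∀ k, MemLp (Z' k) 2 P)
    (h : ∀ i k, cov[Z i, Z' (i + k); P] = g k) (h' : ∀ i k, cov[Z' i, Z (i + k); P] = g' k)
    (N : ℕ) :
    cov[fun ω => ∑ k ∈ Finset.range N, Z k ω, fun ω => ∑ k ∈ Finset.range N, Z' k ω; P]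
      = ∑ i ∈ Finset.range N, (g 0 + ∑ k ∈ Finset.range i, g (k + 1)
        + ∑ k ∈ Finset.range i, g' (k + 1)) := by
  have hS : ∀ N, MemLp (fun ω => ∑ k ∈ Finset.range N, Z k ω) 2 P := fun N =>
    memLp_finsetSum _ fun k _ => hZ k
  have hS' : ∀ N, MemLp (fun ω => ∑ k ∈ Finset.range N, Z' k ω) 2 P := fun N =>
    memLp_finsetSum _ fun k _ => hZ' k
  induction N with
  | zero => simp [covariance]
  | succ N ih =>
    simp_rw [Finset.sum_range_succ]
    have h1 := covariance_add_left (hS N) (hZ N) ((hS' N).add (hZ' N))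
    have h2 := covariance_add_right (hS N) (hS' N) (hZ' N)
    have h3 := covariance_add_right (hZ N) (hS' N) (hZ' N)
    have h4 := covariance_last_sum hZ hZ' h' N
    have h5 := covariance_last_sum hZ' hZ h N
    have h6 := h N 0
    rw [covariance_comm] at h5
    rw [add_zero] at h6
    refine h1.trans ?_
    refine (congrArg₂ (· + ·) h2 h3).trans ?_
    rw [ih, h4, h5, h6]
    ring

/-- The limit of the normalized covariances of the partial sums of two jointly weakly stationary
sequences with summable cross-covariances. -/
lemma tendsto_covariance_sum_div (hZ : ∀ k, MemLp (Z k) 2 P) (hZ' : ∀ k, MemLp (Z' k) 2 P)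
    (h : ∀ i k, cov[Z i, Z' (i + k); P] = g k) (h' : ∀ i k, cov[Z' i, Z (i + k); P] = g' k)
    {a a' : ℝ} (hg : HasSum (fun k => g (k + 1)) a) (hg' : HasSum (fun k => g' (k + 1)) a') :
    Tendsto (fun N : ℕ =>
      cov[fun ω => ∑ k ∈ Finset.range N, Z k ω, fun ω => ∑ k ∈ Finset.range N, Z' k ω; P] / N)
      atTop (𝓝 (g 0 + a + a')) := by
  -- The increments in `N` converge, so their Cesàro means have the same limit.
  have h1 := ((hg.tendsto_sum_nat.const_add (g 0)).add hg'.tendsto_sum_nat).cesaro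
  refine h1.congr fun N => ?_
  rw [covariance_sum_sum_eq hZ hZ' h h', div_eq_inv_mul]

end Covariance

/-! ### Covariances along a stationary chain -/

lemma IsMarkovShift.isProbabilityMeasure_mixture {E S : Type*} [MeasurableSpace E]
    [MeasurableSpace S] [Fintype S] {T : E → E} {X : E → S} {μ : S → Measure E} {Q : S → S → ℝ}
    {π : S → ℝ} (h : IsMarkovShift T X μ Q) (hπ : ∀ x, 0 ≤ π x)
    (hπ1 : ∑ x, π x = 1) : IsProbabilityMeasure (mixture π μ) := by
  have := h.prob
  refine ⟨?_⟩
  simp only [mixture, Measure.coe_finsetSum, Finset.sum_apply, Measure.smul_apply, measure_univ,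
    smul_eq_mul, mul_one]
  rw [← ENNReal.ofReal_sum_of_nonneg fun x _ => hπ x, hπ1, ENNReal.ofReal_one]

namespace IsMarkovShift

variable {E S : Type*} [MeasurableSpace E] [MeasurableSpace S] [Fintype S]
  [DiscreteMeasurableSpace S] {T : E → E} {X : E → S} {μ : S → Measure E} {Q : S → S → ℝ}
  {π : S → ℝ} {d d' : S → S → ℝ} {φ ψ : S → ℝ} {α β c α' β' c' lam kap : ℝ}

lemma memLp_pair (h : IsMarkovShift T X μ Q) (D : S → S → ℝ) (k : ℕ) (ν : Measure E)
    [IsFiniteMeasure ν] : MemLp (fun e => D (X (T^[k] e)) (X (T^[k + 1] e))) 2 ν := by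
  obtain ⟨C, hC⟩ := Finite.exists_le fun s : S × S => ‖D s.1 s.2‖
  have hm : Measurable fun s : S × S => D s.1 s.2 := .of_discrete
  exact MemLp.of_bound (hm.comp ((h.measurable_iterate k).prodMk
    (h.measurable_iterate (k + 1)))).aestronglyMeasurable C (ae_of_all _ fun e => hC (_, _))

lemma integral_pair_mixture (h : IsMarkovShift T X μ Q) (hπ : ∀ x, 0 ≤ π x)
    (hst : ∀ y, ∑ x, π x * Q x y = π y) (D : S → S → ℝ) (k : ℕ) :
    ∫ e, D (X (T^[k] e)) (X (T^[k + 1] e)) ∂mixture π μ = pairMean π Q D := by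
  have h0 : ∀ y, Integrable (fun e => D (X e) (X (T e))) (μ y) := fun y =>
    h.integrable_pair D 0 1 y
  have h1 := h.integral_iterate_mixture hπ hst h0 k
  simp_rw [Function.iterate_succ_apply']
  rw [h1, integral_mixture hπ h0, pairMean_apply]
  exact Finset.sum_congr rfl fun x _ => by
    rw [h.integral_pair D x, smul_eq_mul]; rfl

lemma covariance_pair_self (h : IsMarkovShift T X μ Q) (hπ : ∀ x, 0 ≤ π x) (hπ1 : ∑ x, π x = 1)
    (hst : ∀ y, ∑ x, π x * Q x y = π y) (D D' : S → S → ℝ) (i : ℕ) :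
    cov[fun e => D (X (T^[i] e)) (X (T^[i + 1] e)),
        fun e => D' (X (T^[i] e)) (X (T^[i + 1] e)); mixture π μ]
      = pairMean π Q (fun x y => D x y * D' x y) - pairMean π Q D * pairMean π Q D' := by
  have := h.isProbabilityMeasure_mixture hπ hπ1
  rw [covariance_eq_sub (h.memLp_pair D i _) (h.memLp_pair D' i _),
    h.integral_pair_mixture hπ hst, h.integral_pair_mixture hπ hst]
  congr 1
  exact h.integral_pair_mixture hπ hst (fun x y => D x y * D' x y) i

/-- Conditioned on the second state, the later term has mean `α lam ^ k φ + β kap ^ k ψ + c`. The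
part from `c` cancels against the product of the means and only the geometric terms survive. -/
lemma covariance_pair_succ (h : IsMarkovShift T X μ Q) (hπ : ∀ x, 0 ≤ π x) (hπ1 : ∑ x, π x = 1)
    (hst : ∀ y, ∑ x, π x * Q x y = π y)
    (hφ : ∀ x, ∑ y, Q x y * φ y = lam * φ x) (hψ : ∀ x, ∑ y, Q x y * ψ y = kap * ψ x)
    (D : S → S → ℝ) (hd : ∀ x, ∑ y, Q x y * d x y = α * φ x + β * ψ x + c)
    (hc : pairMean π Q d = c) (i k : ℕ) :
    cov[fun e => D (X (T^[i] e)) (X (T^[i + 1] e)),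
        fun e => d (X (T^[i + (k + 1)] e)) (X (T^[i + (k + 1) + 1] e)); mixture π μ]
      = α * lam ^ k * pairMean π Q (fun x y => D x y * φ y)
        + β * kap ^ k * pairMean π Q (fun x y => D x y * ψ y) := by
  have := h.isProbabilityMeasure_mixture hπ hπ1
  have := h.prob
  have hint : ∀ y, Integrable (fun e => D (X e) (X (T e))
      * d (X (T^[k + 1] e)) (X (T^[k + 2] e))) (μ y) := fun y =>
    (h.memLp_pair d (k + 1) (μ y)).integrable_mul (p := 2) (q := 2) (h.memLp_pair D 0 (μ y))
      |>.congr (ae_of_all _ fun e => mul_comm _ _)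
  rw [covariance_eq_sub (h.memLp_pair D i _) (h.memLp_pair d _ _),
    h.integral_pair_mixture hπ hst, h.integral_pair_mixture hπ hst, hc]
  have h1 := h.integral_iterate_mixture hπ hst hint i
  have h2 : ∀ e, D (X (T^[i] e)) (X (T (T^[i] e)))
      * d (X (T^[k + 1] (T^[i] e))) (X (T^[k + 2] (T^[i] e)))
      = ((fun e => D (X (T^[i] e)) (X (T^[i + 1] e)))
        * fun e => d (X (T^[i + (k + 1)] e)) (X (T^[i + (k + 1) + 1] e))) e := fun e => by
    simp only [Pi.mul_apply]
    rw [← Function.iterate_succ_apply' T i e, ← Function.iterate_add_apply, ← Function.iterate_add_apply,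
      add_comm (k + 1) i, add_comm (k + 2) i]
    rfl
  simp_rw [h2] at h1
  rw [h1, integral_mixture hπ hint]
  simp_rw [h.integral_pair_mul_pair D hd hφ hψ k, smul_eq_mul, ← pairMean_apply]
  have h3 : (fun x y => D x y * (α * lam ^ k * φ y + β * kap ^ k * ψ y + c))
      = (α * lam ^ k) • (fun x y => D x y * φ y) + (β * kap ^ k) • (fun x y => D x y * ψ y)
        + c • D := by
    ext x y
    simp only [Pi.add_apply, Pi.smul_apply, smul_eq_mul]
    ring
  rw [h3, map_add, map_add, map_smul, map_smul, map_smul]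
  simp only [smul_eq_mul]
  ring

end IsMarkovShift

/-- The asymptotic covariance of the partial sums of `d` and `d'` along a stationary Markov chain
whose transitions map `d` and `d'` to combinations of two eigenfunctions. -/
noncomputable def asymCov {S : Type*} [Fintype S] (π : S → ℝ) (Q : S → S → ℝ) (φ ψ : S → ℝ)
    (lam kap : ℝ) (d : S → S → ℝ) (α β : ℝ) (d' : S → S → ℝ) (α' β' : ℝ) : ℝ :=
  pairMean π Q (fun x y => d x y * d' x y) - pairMean π Q d * pairMean π Q d'
    + (α' * (1 - lam)⁻¹ * pairMean π Q (fun x y => d x y * φ y)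
      + β' * (1 - kap)⁻¹ * pairMean π Q (fun x y => d x y * ψ y))
    + (α * (1 - lam)⁻¹ * pairMean π Q (fun x y => d' x y * φ y)
      + β * (1 - kap)⁻¹ * pairMean π Q (fun x y => d' x y * ψ y))

namespace IsMarkovShift

variable {E S : Type*} [MeasurableSpace E] [MeasurableSpace S] [Fintype S]
  [DiscreteMeasurableSpace S] {T : E → E} {X : E → S} {μ : S → Measure E} {Q : S → S → ℝ}
  {π : S → ℝ} {d d' : S → S → ℝ} {φ ψ : S → ℝ} {α β c α' β' c' lam kap : ℝ}

lemma hasSum_geometric_combination (hlam : |lam| < 1) (hkap : |kap| < 1) (a b : ℝ) :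
    HasSum (fun k : ℕ => α * lam ^ k * a + β * kap ^ k * b)
      (α * (1 - lam)⁻¹ * a + β * (1 - kap)⁻¹ * b) :=
  (((hasSum_geometric_of_abs_lt_one hlam).mul_left α).mul_right a).add
    (((hasSum_geometric_of_abs_lt_one hkap).mul_left β).mul_right b)

/-- The second limit handles a boundary term: for equal `K` the lag-zero sum has one more summand
than the lag-one sum, and boundedness of its covariance makes it negligible. -/
lemma tendsto_covariance_pair (h : IsMarkovShift T X μ Q) (hπ : ∀ x, 0 ≤ π x)
    (hπ1 : ∑ x, π x = 1) (hst : ∀ y, ∑ x, π x * Q x y = π y)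
    (hφ : ∀ x, ∑ y, Q x y * φ y = lam * φ x) (hψ : ∀ x, ∑ y, Q x y * ψ y = kap * ψ x)
    (hlam : |lam| < 1) (hkap : |kap| < 1)
    (hd : ∀ x, ∑ y, Q x y * d x y = α * φ x + β * ψ x + c) (hc : pairMean π Q d = c)
    (hd' : ∀ x, ∑ y, Q x y * d' x y = α' * φ x + β' * ψ x + c') (hc' : pairMean π Q d' = c') :
    Tendsto (fun N : ℕ => cov[
        fun e => ∑ k ∈ Finset.range N, d (X (T^[k] e)) (X (T^[k + 1] e)),
        fun e => ∑ k ∈ Finset.range N, d' (X (T^[k] e)) (X (T^[k + 1] e)); mixture π μ] / N) atTop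
      (𝓝 (asymCov π Q φ ψ lam kap d α β d' α' β')) ∧
    Tendsto (fun N : ℕ => cov[
        fun e => d (X (T^[N] e)) (X (T^[N + 1] e)),
        fun e => ∑ k ∈ Finset.range N, d' (X (T^[k] e)) (X (T^[k + 1] e)); mixture π μ]) atTop
      (𝓝 (α * (1 - lam)⁻¹ * pairMean π Q (fun x y => d' x y * φ y)
        + β * (1 - kap)⁻¹ * pairMean π Q (fun x y => d' x y * ψ y))) := by
  have := h.isProbabilityMeasure_mixture hπ hπ1
  let g : (S → S → ℝ) → ℝ → ℝ → (S → S → ℝ) → ℕ → ℝ := fun D a b D' k =>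
    Nat.casesOn k (pairMean π Q (fun x y => D x y * D' x y) - pairMean π Q D * pairMean π Q D')
      fun k => a * lam ^ k * pairMean π Q (fun x y => D x y * φ y)
        + b * kap ^ k * pairMean π Q (fun x y => D x y * ψ y)
  have hg : ∀ i k, cov[fun e => d (X (T^[i] e)) (X (T^[i + 1] e)),
      fun e => d' (X (T^[i + k] e)) (X (T^[i + k + 1] e)); mixture π μ] = g d α' β' d' k := by
    intro i k
    cases k with
    | zero => exact h.covariance_pair_self hπ hπ1 hst d d' i
    | succ k => exact h.covariance_pair_succ hπ hπ1 hst hφ hψ d hd' hc' i k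
  have hg' : ∀ i k, cov[fun e => d' (X (T^[i] e)) (X (T^[i + 1] e)),
      fun e => d (X (T^[i + k] e)) (X (T^[i + k + 1] e)); mixture π μ] = g d' α β d k := by
    intro i k
    cases k with
    | zero => exact h.covariance_pair_self hπ hπ1 hst d' d i
    | succ k => exact h.covariance_pair_succ hπ hπ1 hst hφ hψ d' hd hc i k
  have hs : ∀ (D : S → S → ℝ) (a b : ℝ) (D' : S → S → ℝ), HasSum (fun k => g D a b D' (k + 1))
      (a * (1 - lam)⁻¹ * pairMean π Q (fun x y => D x y * φ y)
        + b * (1 - kap)⁻¹ * pairMean π Q (fun x y => D x y * ψ y)) := fun D a b D' =>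
    hasSum_geometric_combination hlam hkap _ _
  have hL : ∀ (D : S → S → ℝ) (k : ℕ),
      MemLp (fun e => D (X (T^[k] e)) (X (T^[k + 1] e))) 2 (mixture π μ) := fun D k =>
    h.memLp_pair D k _
  refine ⟨tendsto_covariance_sum_div (hL d) (hL d') hg hg' (hs d α' β' d') (hs d' α β d), ?_⟩
  refine (hs d' α β d).tendsto_sum_nat.congr fun N => ?_
  exact (covariance_last_sum (hL d) (hL d') hg' N).symm

end IsMarkovShift

section AsymCov

variable {S : Type*} [Fintype S] {Q : S → S → ℝ} {π : S → ℝ} {d d' : S → S → ℝ} {φ ψ : S → ℝ}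
  {α β c α' β' c' lam kap : ℝ}

lemma pairMean_const (hQ1 : ∀ x, ∑ y, Q x y = 1) (hπ1 : ∑ x, π x = 1) (r : ℝ) :
    pairMean π Q (fun _ _ => r) = r := by
  simp_rw [pairMean_apply, ← Finset.sum_mul, hQ1, one_mul, ← Finset.sum_mul, hπ1, one_mul]

/-- By stationarity the mean equals `lam` times itself. -/
lemma pairMean_eigenfunction (hst : ∀ y, ∑ x, π x * Q x y = π y)
    (hφ : ∀ x, ∑ y, Q x y * φ y = lam * φ x) (hlam : lam ≠ 1) :
    pairMean π Q (fun _ y => φ y) = 0 := by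
  have h1 : pairMean π Q (fun _ y => φ y) = ∑ y, π y * φ y := by
    simp_rw [pairMean_apply, Finset.mul_sum, ← mul_assoc]
    rw [Finset.sum_comm]
    simp_rw [← Finset.sum_mul, hst]
  have h2 : pairMean π Q (fun _ y => φ y) = lam * ∑ y, π y * φ y := by
    simp_rw [pairMean_apply, hφ, mul_left_comm _ lam, ← Finset.mul_sum]
  have h3 : (1 - lam) * ∑ y, π y * φ y = 0 := by linear_combination h2 - h1
  rw [h1]
  exact (mul_eq_zero.1 h3).resolve_left (sub_ne_zero.2 hlam.symm)

/-- Bilinearity, together with the irrelevance of constants. It turns the limit variances of linear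
combinations into the quadratic form of a covariance matrix. -/
lemma asymCov_combination (hQ1 : ∀ x, ∑ y, Q x y = 1) (hπ1 : ∑ x, π x = 1)
    (hφ0 : pairMean π Q (fun _ y => φ y) = 0) (hψ0 : pairMean π Q (fun _ y => ψ y) = 0)
    (t t' r r' : ℝ) :
    asymCov π Q φ ψ lam kap (fun x y => t * (d x y - r) + t' * (d' x y - r'))
        (t * α + t' * α') (t * β + t' * β')
        (fun x y => t * (d x y - r) + t' * (d' x y - r')) (t * α + t' * α') (t * β + t' * β')
      = t ^ 2 * asymCov π Q φ ψ lam kap d α β d α β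
        + 2 * t * t' * asymCov π Q φ ψ lam kap d α β d' α' β'
        + t' ^ 2 * asymCov π Q φ ψ lam kap d' α' β' d' α' β' := by
  let u : ℝ := t * r + t' * r'
  have e1 : (fun x y => (t * (d x y - r) + t' * (d' x y - r'))
        * (t * (d x y - r) + t' * (d' x y - r')))
      = (t ^ 2) • (fun x y => d x y * d x y) + (2 * t * t') • (fun x y => d x y * d' x y)
        + (t' ^ 2) • (fun x y => d' x y * d' x y) + (-2 * u * t) • d + (-2 * u * t') • d'
        + fun _ _ => u ^ 2 := by
    ext x y
    simp only [Pi.add_apply, Pi.smul_apply, smul_eq_mul, u]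
    ring
  have e2 : (fun x y => t * (d x y - r) + t' * (d' x y - r'))
      = t • d + t' • d' + fun _ _ => -u := by
    ext x y
    simp only [Pi.add_apply, Pi.smul_apply, smul_eq_mul, u]
    ring
  have e3 : ∀ χ : S → ℝ, (fun x y => (t * (d x y - r) + t' * (d' x y - r')) * χ y)
      = t • (fun x y => d x y * χ y) + t' • (fun x y => d' x y * χ y)
        + (-u) • fun _ y => χ y := fun χ => by
    ext x y
    simp only [Pi.add_apply, Pi.smul_apply, smul_eq_mul, u]
    ring
  simp only [asymCov]
  rw [e1, e2, e3, e3]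
  simp only [map_add, map_smul, smul_eq_mul, pairMean_const hQ1 hπ1, hφ0, hψ0]
  have e4 : pairMean π Q (fun x y => d' x y * d x y) = pairMean π Q fun x y => d x y * d' x y := by
    simp_rw [mul_comm]
  ring

end AsymCov

/-! ### Convergence of characteristic functions -/

namespace IsMarkovShift

variable {E S : Type*} [MeasurableSpace E] [MeasurableSpace S] [Fintype S]
  [DiscreteMeasurableSpace S] {T : E → E} {X : E → S} {μ : S → Measure E} {Q : S → S → ℝ}
  {π : S → ℝ} {d : S → S → ℝ} {φ ψ : S → ℝ} {α β lam kap : ℝ}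

lemma memLp_sum (h : IsMarkovShift T X μ Q) (D : S → S → ℝ) (N : ℕ) (ν : Measure E)
    [IsFiniteMeasure ν] :
    MemLp (fun e => ∑ k ∈ Finset.range N, D (X (T^[k] e)) (X (T^[k + 1] e))) 2 ν :=
  memLp_finsetSum _ fun k _ => h.memLp_pair D k ν

lemma measurable_sum (h : IsMarkovShift T X μ Q) (D : S → S → ℝ) (N : ℕ) :
    Measurable (fun e => ∑ k ∈ Finset.range N, D (X (T^[k] e)) (X (T^[k + 1] e))) := by
  refine Finset.measurable_fun_sum _ fun k _ => ?_
  have hm : Measurable fun s : S × S => D s.1 s.2 := .of_discrete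
  exact hm.comp ((h.measurable_iterate k).prodMk (h.measurable_iterate (k + 1)))

/-- The central limit theorem for the additive functionals of a stationary Markov chain, in terms of
characteristic functions. -/
theorem tendsto_integral_exp (h : IsMarkovShift T X μ Q) (hQ : ∀ x y, 0 < Q x y)
    (hπ : ∀ x, 0 ≤ π x) (hπ1 : ∑ x, π x = 1) (hst : ∀ y, ∑ x, π x * Q x y = π y)
    (hφ : ∀ x, ∑ y, Q x y * φ y = lam * φ x) (hψ : ∀ x, ∑ y, Q x y * ψ y = kap * ψ x)
    (hlam : |lam| < 1) (hkap : |kap| < 1)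
    (hd : ∀ x, ∑ y, Q x y * d x y = α * φ x + β * ψ x) :
    0 ≤ asymCov π Q φ ψ lam kap d α β d α β ∧
    Tendsto (fun N : ℕ => ∫ e, Complex.exp (((√(N : ℝ))⁻¹ *
        ∑ k ∈ Finset.range N, d (X (T^[k] e)) (X (T^[k + 1] e)) : ℝ) * Complex.I) ∂mixture π μ)
      atTop (𝓝 (Complex.exp (-(asymCov π Q φ ψ lam kap d α β d α β : ℝ) / 2))) := by
  have := h.isProbabilityMeasure_mixture hπ hπ1
  have hlam1 : 1 - lam ≠ 0 := by have := (abs_lt.1 hlam).2; linarith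
  have hkap1 : 1 - kap ≠ 0 := by have := (abs_lt.1 hkap).2; linarith
  have hφ0 := pairMean_eigenfunction hst hφ (sub_ne_zero.1 hlam1).symm
  have hψ0 := pairMean_eigenfunction hst hψ (sub_ne_zero.1 hkap1).symm
  -- Given the first state, `d` averages to a combination of eigenfunctions, and stationarity makes
  -- their means vanish at either end of a transition.
  have hd0 : pairMean π Q d = 0 := by
    have h1 : pairMean π Q d = pairMean π Q (fun x _ => α * φ x + β * ψ x) := by
      simp_rw [pairMean_apply, hd, ← Finset.sum_mul, h.sum_eq_one, one_mul]
    have h2 : ∀ χ : S → ℝ, pairMean π Q (fun x _ => χ x) = pairMean π Q (fun _ y => χ y) := by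
      intro χ
      simp_rw [pairMean_apply, ← Finset.sum_mul, h.sum_eq_one, one_mul, Finset.mul_sum, ← mul_assoc]
      rw [Finset.sum_comm]
      simp_rw [← Finset.sum_mul, hst]
    rw [h1, h2 fun x => α * φ x + β * ψ x]
    have h3 : (fun _ y => α * φ y + β * ψ y : S → S → ℝ)
        = α • (fun _ y => φ y) + β • (fun _ y => ψ y) := rfl
    rw [h3, map_add, map_smul, map_smul, hφ0, hψ0, smul_zero, smul_zero, add_zero]
  -- A limit of normalized variances.
  have hs0 : 0 ≤ asymCov π Q φ ψ lam kap d α β d α β := by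
    have hd' : ∀ x, ∑ y, Q x y * d x y = α * φ x + β * ψ x + 0 := fun x => by rw [hd, add_zero]
    refine ge_of_tendsto' (h.tendsto_covariance_pair hπ hπ1 hst hφ hψ hlam hkap hd' hd0 hd'
      hd0).1 fun N => div_nonneg ?_ (Nat.cast_nonneg N)
    rw [covariance_self (h.measurable_sum d N).aemeasurable]
    exact variance_nonneg _ _
  refine ⟨hs0, ?_⟩
  -- On an eigenfunction with eigenvalue `lam` the operator `1 - Q` is inverted by the factor `(1 -
  -- lam)⁻¹`, so the first Poisson equation has an explicit solution.
  let u : S → ℝ := fun y => α * (1 - lam)⁻¹ * φ y + β * (1 - kap)⁻¹ * ψ y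
  have hu : ∀ x, u x - ∑ y, Q x y * u y = ∑ y, Q x y * d x y := fun x => by
    have h1 : ∀ y, Q x y * u y
        = α * (1 - lam)⁻¹ * (Q x y * φ y) + β * (1 - kap)⁻¹ * (Q x y * ψ y) := fun y => by
      simp only [u]; ring
    simp_rw [h1, Finset.sum_add_distrib, ← Finset.mul_sum, hφ, hψ, hd, u]
    field_simp
    ring
  have hs : asymCov π Q φ ψ lam kap d α β d α β
      = ∑ x, π x * ∑ y, Q x y * (d x y ^ 2 + 2 * d x y * u y) := by
    rw [← pairMean_apply π Q fun x y => d x y ^ 2 + 2 * d x y * u y]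
    have h1 : (fun x y => d x y ^ 2 + 2 * d x y * u y)
        = (fun x y => d x y * d x y) + (2 * (α * (1 - lam)⁻¹)) • (fun x y => d x y * φ y)
          + (2 * (β * (1 - kap)⁻¹)) • (fun x y => d x y * ψ y) := by
      ext x y
      simp only [Pi.add_apply, Pi.smul_apply, smul_eq_mul, u]
      ring
    rw [h1, map_add, map_add, map_smul, map_smul, asymCov, hd0]
    simp only [smul_eq_mul]
    ring
  have hmain := tendsto_pi_nhds.1
    (tendsto_transfer_pow hQ h.sum_eq_one hπ1 hst hu hs0 hs)
  have hsum := tendsto_finsetSum Finset.univ fun x _ => (hmain x).const_mul (π x : ℂ)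
  rw [← Finset.sum_mul, ← Complex.ofReal_sum, hπ1, Complex.ofReal_one, one_mul] at hsum
  refine hsum.congr fun N => ?_
  have hpath := fun x => h.integral_prod_path
    (fun x y => Complex.exp ((√(N : ℝ))⁻¹ * d x y * Complex.I)) (transfer Q _)
    (transfer_apply Q _) N x
  have hexp : ∀ e, Complex.exp (((√(N : ℝ))⁻¹ *
        ∑ k ∈ Finset.range N, d (X (T^[k] e)) (X (T^[k + 1] e)) : ℝ) * Complex.I)
      = ∏ k ∈ Finset.range N,
        Complex.exp ((√(N : ℝ))⁻¹ * d (X (T^[k] e)) (X (T^[k + 1] e)) * Complex.I) := fun e => by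
    rw [← Complex.exp_sum, ← Finset.sum_mul, ← Finset.mul_sum]
    push_cast
    rfl
  simp_rw [hexp]
  rw [integral_mixture hπ fun y => (hpath y).1 y]
  refine Finset.sum_congr rfl fun x _ => ?_
  rw [(hpath x).2, Complex.real_smul]

end IsMarkovShift

lemma norm_exp_mul_I_sub_le (a b : ℝ) :
    ‖Complex.exp (a * Complex.I) - Complex.exp (b * Complex.I)‖ ≤ |a - b| := by
  have h : Complex.exp (a * Complex.I) - Complex.exp (b * Complex.I)
      = Complex.exp (b * Complex.I) * (Complex.exp (Complex.I * (a - b : ℝ)) - 1) := by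
    rw [mul_sub, mul_one, ← Complex.exp_add]
    congr 2
    push_cast
    ring
  rw [h, norm_mul, Complex.norm_exp_ofReal_mul_I, one_mul]
  exact Real.norm_exp_I_mul_ofReal_sub_one_le

/-- A Slutsky argument with a deterministic error bound: `x ↦ exp (i x)` is `1`-Lipschitz. -/
lemma tendsto_integral_exp_of_abs_sub_le {Ω : Type*} [MeasurableSpace Ω] {P : Measure Ω}
    [IsProbabilityMeasure P] {U W : ℕ → Ω → ℝ} (hU : ∀ N, AEMeasurable (U N) P)
    (hW : ∀ N, AEMeasurable (W N) P) {b : ℕ → ℝ} (hb : Tendsto b atTop (𝓝 0))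
    (hUW : ∀ᶠ N in atTop, ∀ᵐ ω ∂P, |U N ω - W N ω| ≤ b N) {z : ℂ}
    (h : Tendsto (fun N => ∫ ω, Complex.exp (W N ω * Complex.I) ∂P) atTop (𝓝 z)) :
    Tendsto (fun N => ∫ ω, Complex.exp (U N ω * Complex.I) ∂P) atTop (𝓝 z) := by
  have hint : ∀ {V : Ω → ℝ}, AEMeasurable V P →
      Integrable (fun ω => Complex.exp (V ω * Complex.I)) P := fun {V} hV => by
    refine Integrable.of_bound (AEMeasurable.aestronglyMeasurable (by fun_prop)) 1
      (ae_of_all _ fun ω => ?_)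
    rw [Complex.norm_exp_ofReal_mul_I]
  have h1 : Tendsto (fun N => ∫ ω, Complex.exp (U N ω * Complex.I) ∂P
      - ∫ ω, Complex.exp (W N ω * Complex.I) ∂P) atTop (𝓝 0) := by
    refine squeeze_zero_norm' ?_ hb
    filter_upwards [hUW] with N hN
    rw [← integral_sub (hint (hU N)) (hint (hW N))]
    refine (norm_integral_le_of_norm_le_const (C := b N) ?_).trans ?_
    · filter_upwards [hN] with ω hω
      exact (norm_exp_mul_I_sub_le _ _).trans hω
    · simp
  simpa using h1.add h

/-! ### Closed forms of the asymptotic covariances -/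

section Graph

variable {n : ℕ} {p q : ℝ}

/-- The summand of the empirical mean, as a function of two consecutive states. -/
def meanTerm (x _y : Fin n → Bool) : ℝ := onCount x

/-- The summand of the empirical lag-one moment, as a function of two consecutive states. -/
def prodTerm (x y : Fin n → Bool) : ℝ := onCount x * onCount y

/-- The stationary law of the data of `n` independent edges. -/
noncomputable def graphLaw (n : ℕ) (p q : ℝ) : Measure (Fin n → EdgeData) :=
  mixture (stat p q) (startAll p q)

/-- The value of `D` at the states at the times `k + 1` and `k + 2`. -/
def pathTerm (D : (Fin n → Bool) → (Fin n → Bool) → ℝ) (k : ℕ) (e : Fin n → EdgeData) : ℝ :=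
  D (states (stepAll^[k] e)) (states (stepAll^[k + 1] e))

/-- The sum of the first `N` values of `D` along the path. -/
def pathSum (D : (Fin n → Bool) → (Fin n → Bool) → ℝ) (N : ℕ) (e : Fin n → EdgeData) : ℝ :=
  ∑ k ∈ Finset.range N, pathTerm D k e

lemma abs_ff_lt_one (hp : p ∈ Set.Ioo (0 : ℝ) 1) (hq : q ∈ Set.Ioo (0 : ℝ) 1) :
    |ff p q| < 1 := by
  rw [ff, abs_lt]
  constructor <;> linarith [hp.1, hp.2, hq.1, hq.2]

lemma abs_ff_sq_lt_one (hp : p ∈ Set.Ioo (0 : ℝ) 1) (hq : q ∈ Set.Ioo (0 : ℝ) 1) :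
    |ff p q ^ 2| < 1 := by
  rw [abs_pow]
  exact pow_lt_one₀ (abs_nonneg _) (abs_ff_lt_one hp hq) two_ne_zero

lemma pairMean_meanTerm :
    pairMean (stat p q) (trans p q) (meanTerm (n := n)) = binMoment n p q 1 := by
  have := pairMean_onCount_left (n := n) (p := p) (q := q) 1
  simp only [pow_one] at this
  exact this

lemma pairMean_prodTerm :
    pairMean (stat p q) (trans p q) (prodTerm (n := n)) = jointMoment1 n p q :=
  pairMean_jointMoment1

/-- The asymptotic covariance of the partial sums of two functions of consecutive states. -/
noncomputable def graphCov (p q : ℝ) (D : (Fin n → Bool) → (Fin n → Bool) → ℝ) (α β : ℝ)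
    (D' : (Fin n → Bool) → (Fin n → Bool) → ℝ) (α' β' : ℝ) : ℝ :=
  asymCov (stat p q) (trans p q) (eigenLin p q) (eigenQuad p q) (ff p q) (ff p q ^ 2) D α β D' α' β'

/-- The asymptotic variance of the empirical mean. -/
noncomputable def meanVar (n : ℕ) (p q : ℝ) : ℝ :=
  graphCov p q (meanTerm (n := n)) 1 0 (meanTerm (n := n)) 1 0

/-- The asymptotic variance of the empirical lag-one moment. -/
noncomputable def prodVar (n : ℕ) (p q : ℝ) : ℝ :=
  graphCov p q (prodTerm (n := n)) (linCoef n p q) (ff p q)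
    (prodTerm (n := n)) (linCoef n p q) (ff p q)

/-- The asymptotic covariance of the empirical mean and the empirical lag-one moment. -/
noncomputable def mixedCov (n : ℕ) (p q : ℝ) : ℝ :=
  graphCov p q (meanTerm (n := n)) 1 0 (prodTerm (n := n)) (linCoef n p q) (ff p q)

lemma pairMean_meanTerm_eigenLin (h : p + q ≠ 0) :
    pairMean (stat p q) (trans p q) (fun x y : Fin n → Bool => meanTerm x y * eigenLin p q y)
      = ff p q * (binMoment n p q 2 - n * rho p q * binMoment n p q 1) := by
  have := pairMean_eigenLin (n := n) h 1
  simp only [pow_one] at this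
  exact this

lemma pairMean_meanTerm_eigenQuad (h : p + q ≠ 0) :
    pairMean (stat p q) (trans p q) (fun x y : Fin n → Bool => meanTerm x y * eigenQuad p q y)
      = ff p q ^ 2 * (binMoment n p q 3
        + (2 * rho p q - 1 - 2 * n * rho p q) * binMoment n p q 2
        + n * rho p q ^ 2 * (n - 1) * binMoment n p q 1) := by
  have := pairMean_eigenQuad (n := n) h 1
  simp only [pow_one] at this
  exact this

lemma one_sub_ff_ne_zero (hp : p ∈ Set.Ioo (0 : ℝ) 1) (hq : q ∈ Set.Ioo (0 : ℝ) 1) :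
    1 - ff p q ≠ 0 := by
  have := (abs_lt.1 (abs_ff_lt_one hp hq)).2
  linarith

lemma one_sub_ff_sq_ne_zero (hp : p ∈ Set.Ioo (0 : ℝ) 1) (hq : q ∈ Set.Ioo (0 : ℝ) 1) :
    1 - ff p q ^ 2 ≠ 0 := by
  have := (abs_lt.1 (abs_ff_sq_lt_one hp hq)).2
  linarith

lemma meanVar_eq (hp : p ∈ Set.Ioo (0 : ℝ) 1) (hq : q ∈ Set.Ioo (0 : ℝ) 1) :
    meanVar n p q = n * rho p q * (1 - rho p q) * ((1 + ff p q) / (1 - ff p q)) := by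
  have h : p + q ≠ 0 := by linarith [hp.1, hq.1]
  have h1 := one_sub_ff_ne_zero hp hq
  have h2 : pairMean (stat p q) (trans p q) (fun x y : Fin n → Bool => meanTerm x y * meanTerm x y)
      = binMoment n p q 2 := by
    have := pairMean_onCount_left (n := n) (p := p) (q := q) 2
    simp only [sq] at this
    exact this
  rw [meanVar, graphCov, asymCov, h2, pairMean_meanTerm, pairMean_meanTerm_eigenLin h,
    binMoment_one, binMoment_two]
  field_simp
  ring

lemma meanVar_eq' (hp : p ∈ Set.Ioo (0 : ℝ) 1) (hq : q ∈ Set.Ioo (0 : ℝ) 1) :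
    meanVar n p q = n * (p * q * (2 - p - q) / (p + q) ^ 3) := by
  have h : p + q ≠ 0 := by linarith [hp.1, hq.1]
  rw [meanVar_eq hp hq, show 1 - ff p q = p + q by rw [ff]; ring, ff, rho]
  field_simp
  ring

/-- The value of the covariance of `A(1) A(2)` and `A(k + 2) A(k + 3)`. -/
noncomputable def prodCovSucc (n : ℕ) (p q : ℝ) (k : ℕ) : ℝ :=
  linCoef n p q * ff p q ^ k * (jointMoment2 n p q - n * rho p q * jointMoment1 n p q)
    + ff p q * (ff p q ^ 2) ^ k * (jointMoment3 n p q
      + (2 * rho p q - 1 - 2 * n * rho p q) * jointMoment2 n p q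
      + n * rho p q ^ 2 * (n - 1) * jointMoment1 n p q)

/-- The sum of the values `prodCovSucc`. -/
noncomputable def prodCovSum (n : ℕ) (p q : ℝ) : ℝ :=
  linCoef n p q * (1 - ff p q)⁻¹ * (jointMoment2 n p q - n * rho p q * jointMoment1 n p q)
    + ff p q * (1 - ff p q ^ 2)⁻¹ * (jointMoment3 n p q
      + (2 * rho p q - 1 - 2 * n * rho p q) * jointMoment2 n p q
      + n * rho p q ^ 2 * (n - 1) * jointMoment1 n p q)

lemma hasSum_prodCovSucc (hp : p ∈ Set.Ioo (0 : ℝ) 1) (hq : q ∈ Set.Ioo (0 : ℝ) 1) :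
    HasSum (prodCovSucc n p q) (prodCovSum n p q) :=
  IsMarkovShift.hasSum_geometric_combination (abs_ff_lt_one hp hq) (abs_ff_sq_lt_one hp hq) _ _

lemma pairMean_prodTerm_sq :
    pairMean (stat p q) (trans p q) (fun x y : Fin n → Bool => prodTerm x y * prodTerm x y)
      - jointMoment1 n p q * jointMoment1 n p q = t1Form n p q := by
  have h := pairMean_mul_sq (n := n) (p := p) (q := q) 2
  have h1 : (fun x y : Fin n → Bool => prodTerm x y * prodTerm x y)
      = fun x y => onCount x ^ 2 * onCount y ^ 2 := by
    ext x y
    rw [prodTerm]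
    ring
  rw [h1, h, t1Form, sq (jointMoment1 n p q)]

lemma prodVar_eq (n : ℕ) (p q : ℝ) : prodVar n p q = t1Form n p q + 2 * prodCovSum n p q := by
  rw [prodVar, graphCov, asymCov, pairMean_prodTerm, pairMean_prodTerm_sq]
  have h1 : pairMean (stat p q) (trans p q)
      (fun x y : Fin n → Bool => prodTerm x y * eigenLin p q y) = _ := pairMean_mul_eigenLin
  have h2 : pairMean (stat p q) (trans p q)
      (fun x y : Fin n → Bool => prodTerm x y * eigenQuad p q y) = _ := pairMean_mul_eigenQuad
  rw [h1, h2, prodCovSum]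
  ring

/-- By `ϱ (1 - f) = q`, the numerators in the first coefficients of the closed forms of `v₁` and
`c₀₁` agree. -/
lemma linCoef_eq (h : p + q ≠ 0) :
    linCoef n p q = ff p q * (1 - 2 * rho p q) + n * rho p q * (1 + ff p q) := by
  rw [linCoef]
  linear_combination -(n : ℝ) * rho_mul h

lemma prodVar_eq_v1Cancelled (hp : p ∈ Set.Ioo (0 : ℝ) 1) (hq : q ∈ Set.Ioo (0 : ℝ) 1) :
    prodVar n p q = v1Cancelled n p q := by
  have h : p + q ≠ 0 := by linarith [hp.1, hq.1]
  rw [prodVar_eq, prodCovSum, linCoef_eq h, v1Cancelled]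
  ring

lemma v1Cancelled_eq_v1Form (hf : ff p q ≠ 0) : v1Cancelled n p q = v1Form n p q := by
  rw [v1Cancelled, v1Form, c1, c2]
  field_simp

lemma mixedCov_eq (hp : p ∈ Set.Ioo (0 : ℝ) 1) (hq : q ∈ Set.Ioo (0 : ℝ) 1) :
    mixedCov n p q = c01Cancelled n p q := by
  have h : p + q ≠ 0 := by linarith [hp.1, hq.1]
  have h1 := one_sub_ff_ne_zero hp hq
  have h2 := one_sub_ff_sq_ne_zero hp hq
  have h3 : pairMean (stat p q) (trans p q) (fun x y : Fin n → Bool => meanTerm x y * prodTerm x y)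
      = ff p q * binMoment n p q 3 + n * q * binMoment n p q 2 := by
    rw [← pairMean_mul_one (n := n) (p := p) (q := q) 2]
    congr 1
    ext x y
    rw [meanTerm, prodTerm]
    ring
  have h4 : pairMean (stat p q) (trans p q)
      (fun x y : Fin n → Bool => prodTerm x y * eigenLin p q y) = _ := pairMean_mul_eigenLin
  -- The term `A(1)` depends on the first state only, so its covariance with `A(1) A(2)` has the
  -- eigenfunction form too, with both functions taken at the first state. It supplies the leading
  -- terms of the two geometric series, which then sum to multiples of `1 / (1 - f)` and `1 / (1 - f
  -- ^ 2)`.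
  have h5 : ff p q * binMoment n p q 3 + n * q * binMoment n p q 2
        - binMoment n p q 1 * jointMoment1 n p q
      = linCoef n p q * (binMoment n p q 2 - n * rho p q * binMoment n p q 1)
        + ff p q * (binMoment n p q 3 - (2 * n * rho p q - 2 * rho p q + 1) * binMoment n p q 2
        + n * rho p q ^ 2 * (n - 1) * binMoment n p q 1) := by
    rw [jointMoment1, binMoment_one, binMoment_two, linCoef]
    ring
  rw [mixedCov, graphCov, asymCov, pairMean_meanTerm, pairMean_prodTerm, h3, h4, h5,
    pairMean_meanTerm_eigenLin h, pairMean_meanTerm_eigenQuad h, c01Cancelled, ← linCoef]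
  field_simp
  ring

lemma c01Cancelled_eq_c01Form (hf : ff p q ≠ 0) : c01Cancelled n p q = c01Form n p q := by
  rw [c01Cancelled, c01Form, d1, d2]
  field_simp

lemma isProbabilityMeasure_graphLaw (hp : p ∈ Set.Ioo (0 : ℝ) 1) (hq : q ∈ Set.Ioo (0 : ℝ) 1) :
    IsProbabilityMeasure (graphLaw n p q) :=
  (isMarkovShift hp hq).isProbabilityMeasure_mixture (fun x => (stat_pos hp hq x).le)
    (sum_stat n p q)

lemma integral_pathTerm (hp : p ∈ Set.Ioo (0 : ℝ) 1) (hq : q ∈ Set.Ioo (0 : ℝ) 1)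
    (D : (Fin n → Bool) → (Fin n → Bool) → ℝ) (k : ℕ) :
    ∫ e, pathTerm D k e ∂graphLaw n p q = pairMean (stat p q) (trans p q) D :=
  (isMarkovShift hp hq).integral_pair_mixture (fun x => (stat_pos hp hq x).le)
    (sum_stat_mul_trans hp hq) D k

lemma measurable_pathTerm (D : (Fin n → Bool) → (Fin n → Bool) → ℝ) (k : ℕ) :
    Measurable (pathTerm D k) := by
  -- Only the measurability of the shift and the states is needed, which involves no parameters; any
  -- admissible values do.
  have h := isMarkovShift (n := n) (p := 1 / 2) (q := 1 / 2) (by norm_num) (by norm_num)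
  have hm : Measurable fun s : (Fin n → Bool) × (Fin n → Bool) => D s.1 s.2 := .of_discrete
  exact hm.comp ((h.measurable_iterate k).prodMk (h.measurable_iterate (k + 1)))

lemma measurable_pathSum (D : (Fin n → Bool) → (Fin n → Bool) → ℝ) (N : ℕ) :
    Measurable (pathSum D N) :=
  Finset.measurable_fun_sum _ fun k _ => measurable_pathTerm D k

lemma ae_good_graphLaw (hp : p ∈ Set.Ioo (0 : ℝ) 1) (hq : q ∈ Set.Ioo (0 : ℝ) 1) :
    ∀ᵐ e ∂graphLaw n p q, ∀ k, ∑ j, onInd (e j) (k + 1) = onCount (states (stepAll^[k] e)) := by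
  have h1 : ∀ᵐ e ∂graphLaw n p q, ∀ j, Good (e j) := by
    rw [graphLaw, mixture, ae_iff, Measure.coe_finsetSum, Finset.sum_apply]
    refine Finset.sum_eq_zero fun x _ => ?_
    rw [Measure.smul_apply, ae_iff.1 (ae_good_startAll hp hq x), smul_zero]
  exact h1.mono fun e he k => sum_onInd_succ he k

end Graph

lemma sum_Icc_one {M : Type*} [AddCommMonoid M] (F : ℕ → M) (N : ℕ) :
    ∑ k ∈ Finset.Icc 1 N, F k = ∑ k ∈ Finset.range N, F (k + 1) := by
  induction N with
  | zero => simp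
  | succ N ih => rw [Finset.sum_Icc_succ_top (by omega), ih, Finset.sum_range_succ]

/-! ### From the Markov chain back to the given probability space -/

namespace IsStationaryGraph

variable {Ω : Type*} [MeasurableSpace Ω] {P : Measure Ω} {n : ℕ} {p q : ℝ}
  {ξ : Fin n → Ω → EdgeData}

lemma hasLaw (h : IsStationaryGraph P (geomLaw p) (geomLaw q) ξ) (hp : p ∈ Set.Ioo (0 : ℝ) 1)
    (hq : q ∈ Set.Ioo (0 : ℝ) 1) : HasLaw (fun ω j => ξ j ω) (graphLaw n p q) P := by
  rw [graphLaw, ← pi_edgeLaw hp hq]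
  exact h.indep.hasLaw_pi h.law

/-- Almost surely, the numbers of edges that are on are those along the Markov chain. -/
lemma ae_edgeCount (h : IsStationaryGraph P (geomLaw p) (geomLaw q) ξ)
    (hp : p ∈ Set.Ioo (0 : ℝ) 1) (hq : q ∈ Set.Ioo (0 : ℝ) 1) :
    ∀ᵐ ω ∂P, ∀ k, edgeCount ξ (k + 1) ω = onCount (states (stepAll^[k] fun j => ξ j ω)) := by
  have h1 := h.hasLaw hp hq
  have h2 : ∀ᵐ e ∂P.map (fun ω j => ξ j ω), ∀ k,
      ∑ j, onInd (e j) (k + 1) = onCount (states (stepAll^[k] e)) := by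
    rw [h1.map_eq]
    exact ae_good_graphLaw hp hq
  exact ae_of_ae_map h1.aemeasurable h2

lemma ae_lagTerm (h : IsStationaryGraph P (geomLaw p) (geomLaw q) ξ)
    (hp : p ∈ Set.Ioo (0 : ℝ) 1) (hq : q ∈ Set.Ioo (0 : ℝ) 1) :
    ∀ᵐ ω ∂P, ∀ k, lagTerm ξ 0 (k + 1) ω = pathTerm meanTerm k (fun j => ξ j ω) ∧
      lagTerm ξ 1 (k + 1) ω = pathTerm prodTerm k (fun j => ξ j ω) := by
  filter_upwards [h.ae_edgeCount hp hq] with ω hω k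
  simp only [lagTerm, if_true, one_ne_zero, if_false, hω]
  exact ⟨rfl, rfl⟩

/-- Time `k + 1` is step `k` of the chain, and the lag-one sum up to `N + 1` has only `N` summands.
-/
lemma ae_lagSum (h : IsStationaryGraph P (geomLaw p) (geomLaw q) ξ)
    (hp : p ∈ Set.Ioo (0 : ℝ) 1) (hq : q ∈ Set.Ioo (0 : ℝ) 1) :
    ∀ᵐ ω ∂P, ∀ N, lagSum ξ 0 N ω = pathSum meanTerm N (fun j => ξ j ω) ∧
      lagSum ξ 1 (N + 1) ω = pathSum prodTerm N (fun j => ξ j ω) := by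
  filter_upwards [h.ae_lagTerm hp hq] with ω hω N
  refine ⟨?_, ?_⟩
  · rw [lagSum, sum_Icc_one]
    exact Finset.sum_congr rfl fun k _ => (hω k).1
  · rw [lagSum, sum_Icc_one]
    exact Finset.sum_congr rfl fun k _ => (hω k).2

lemma integral_eq (h : IsStationaryGraph P (geomLaw p) (geomLaw q) ξ)
    (hp : p ∈ Set.Ioo (0 : ℝ) 1) (hq : q ∈ Set.Ioo (0 : ℝ) 1) {F : Ω → ℝ}
    {D : (Fin n → Bool) → (Fin n → Bool) → ℝ} {k : ℕ}
    (hF : ∀ᵐ ω ∂P, F ω = pathTerm D k (fun j => ξ j ω)) :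
    ∫ ω, F ω ∂P = pairMean (stat p q) (trans p q) D := by
  rw [integral_congr_ae hF, ← integral_pathTerm hp hq D k]
  exact (h.hasLaw hp hq).integral_comp (measurable_pathTerm D k).aestronglyMeasurable

lemma lagMean_zero (h : IsStationaryGraph P (geomLaw p) (geomLaw q) ξ)
    (hp : p ∈ Set.Ioo (0 : ℝ) 1) (hq : q ∈ Set.Ioo (0 : ℝ) 1) :
    lagMean P ξ 0 = binMoment n p q 1 :=
  (h.integral_eq hp hq ((h.ae_lagTerm hp hq).mono fun _ hω => (hω 0).1)).trans pairMean_meanTerm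

lemma lagMean_one (h : IsStationaryGraph P (geomLaw p) (geomLaw q) ξ)
    (hp : p ∈ Set.Ioo (0 : ℝ) 1) (hq : q ∈ Set.Ioo (0 : ℝ) 1) :
    lagMean P ξ 1 = jointMoment1 n p q :=
  (h.integral_eq hp hq ((h.ae_lagTerm hp hq).mono fun _ hω => (hω 0).2)).trans pairMean_prodTerm

lemma integral_edgeCount_pow (h : IsStationaryGraph P (geomLaw p) (geomLaw q) ξ)
    (hp : p ∈ Set.Ioo (0 : ℝ) 1) (hq : q ∈ Set.Ioo (0 : ℝ) 1) (i : ℕ) :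
    ∫ ω, edgeCount ξ 1 ω ^ i ∂P = binMoment n p q i := by
  rw [← pairMean_onCount_left]
  refine h.integral_eq hp hq (k := 0) ((h.ae_edgeCount hp hq).mono fun ω hω => ?_)
  rw [hω 0]
  rfl

lemma integral_edgeCount_mul (h : IsStationaryGraph P (geomLaw p) (geomLaw q) ξ)
    (hp : p ∈ Set.Ioo (0 : ℝ) 1) (hq : q ∈ Set.Ioo (0 : ℝ) 1) (i : ℕ) :
    ∫ ω, edgeCount ξ 1 ω * edgeCount ξ 2 ω ^ i ∂P
      = pairMean (stat p q) (trans p q) (fun x y : Fin n → Bool => onCount x * onCount y ^ i) := by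
  refine h.integral_eq hp hq (k := 0) ((h.ae_edgeCount hp hq).mono fun ω hω => ?_)
  rw [hω 0, hω 1]
  rfl

lemma covariance_eq (h : IsStationaryGraph P (geomLaw p) (geomLaw q) ξ)
    (hp : p ∈ Set.Ioo (0 : ℝ) 1) (hq : q ∈ Set.Ioo (0 : ℝ) 1) {F G : Ω → ℝ}
    {F' G' : (Fin n → EdgeData) → ℝ} (hF : ∀ᵐ ω ∂P, F ω = F' (fun j => ξ j ω))
    (hG : ∀ᵐ ω ∂P, G ω = G' (fun j => ξ j ω)) (hF' : Measurable F') (hG' : Measurable G') :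
    cov[F, G; P] = cov[F', G'; graphLaw n p q] := by
  rw [← (h.hasLaw hp hq).covariance_fun_comp hF'.aemeasurable hG'.aemeasurable, covariance,
    covariance, integral_congr_ae hF, integral_congr_ae hG]
  refine integral_congr_ae ?_
  filter_upwards [hF, hG] with ω h1 h2
  rw [h1, h2]

lemma lagCov_one (h : IsStationaryGraph P (geomLaw p) (geomLaw q) ξ)
    (hp : p ∈ Set.Ioo (0 : ℝ) 1) (hq : q ∈ Set.Ioo (0 : ℝ) 1) :
    lagCov P ξ 1 = t1Form n p q := by
  have h1 := (h.ae_lagTerm hp hq).mono fun _ hω => (hω 0).2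
  rw [lagCov, h.covariance_eq hp hq h1 h1 (measurable_pathTerm _ _) (measurable_pathTerm _ _),
    ← pairMean_prodTerm_sq, ← pairMean_prodTerm]
  exact (isMarkovShift hp hq).covariance_pair_self (fun x => (stat_pos hp hq x).le)
    (sum_stat n p q) (sum_stat_mul_trans hp hq) _ _ 0

lemma lagCov_add_two (h : IsStationaryGraph P (geomLaw p) (geomLaw q) ξ)
    (hp : p ∈ Set.Ioo (0 : ℝ) 1) (hq : q ∈ Set.Ioo (0 : ℝ) 1) (k : ℕ) :
    lagCov P ξ (k + 2) = prodCovSucc n p q k := by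
  have h0 : p + q ≠ 0 := by linarith [hp.1, hq.1]
  have h1 := (h.ae_lagTerm hp hq).mono fun _ hω => (hω 0).2
  have h2 := (h.ae_lagTerm hp hq).mono fun _ hω => (hω (0 + (k + 1))).2
  have h3 : k + 2 = 0 + (k + 1) + 1 := by omega
  rw [lagCov, h3, h.covariance_eq hp hq h1 h2 (measurable_pathTerm _ _) (measurable_pathTerm _ _),
    prodCovSucc, ← pairMean_mul_eigenLin, ← pairMean_mul_eigenQuad]
  exact (isMarkovShift hp hq).covariance_pair_succ (fun x => (stat_pos hp hq x).le)
    (sum_stat n p q) (sum_stat_mul_trans hp hq) (sum_trans_eigenLin h0) (sum_trans_eigenQuad h0)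
    prodTerm sum_trans_mul pairMean_prodTerm 0 k

end IsStationaryGraph

/-! ### Limits of the normalized covariances and of the scaled errors -/

section Limits

variable {n : ℕ} {p q : ℝ}

lemma abs_pathSum_le (D : (Fin n → Bool) → (Fin n → Bool) → ℝ) {B : ℝ}
    (hB : ∀ x y, |D x y| ≤ B) (N : ℕ) (e : Fin n → EdgeData) : |pathSum D N e| ≤ N * B := by
  refine (Finset.abs_sum_le_sum_abs _ _).trans ((Finset.sum_le_card_nsmul _ _ B
    fun k _ => hB _ _).trans ?_)
  rw [Finset.card_range, nsmul_eq_mul]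

/-- The lag-one sum at `K = N + 1` has `N` summands but is divided by `N + 1`. -/
lemma tendsto_add_one_div_shift {u : ℕ → ℝ} {l : ℝ}
    (hu : Tendsto (fun N : ℕ => u N / N) atTop (𝓝 l)) :
    Tendsto (fun N : ℕ => u N / ((N + 1 : ℕ) : ℝ)) atTop (𝓝 l) := by
  have h := hu.mul (tendsto_natCast_div_add_atTop (1 : ℝ))
  rw [mul_one] at h
  refine h.congr' ?_
  filter_upwards [eventually_gt_atTop 0] with N hN
  have : (N : ℝ) ≠ 0 := by positivity
  push_cast
  field_simp

variable {Ω : Type*} [MeasurableSpace Ω] {P : Measure Ω} {ξ : Fin n → Ω → EdgeData}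

namespace IsStationaryGraph

lemma aemeasurable_lagSum (h : IsStationaryGraph P (geomLaw p) (geomLaw q) ξ)
    (hp : p ∈ Set.Ioo (0 : ℝ) 1) (hq : q ∈ Set.Ioo (0 : ℝ) 1) (N : ℕ) :
    AEMeasurable (lagSum ξ 0 N) P ∧ AEMeasurable (lagSum ξ 1 N) P := by
  have h1 := (h.hasLaw hp hq).aemeasurable
  refine ⟨((measurable_pathSum meanTerm N).comp_aemeasurable h1).congr
    ((h.ae_lagSum hp hq).mono fun ω hω => (hω N).1.symm), ?_⟩
  cases N with
  | zero => exact aemeasurable_const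
  | succ N =>
    exact ((measurable_pathSum prodTerm N).comp_aemeasurable h1).congr
      ((h.ae_lagSum hp hq).mono fun ω hω => (hω N).2.symm)

lemma tendsto_variance_mean (h : IsStationaryGraph P (geomLaw p) (geomLaw q) ξ)
    (hp : p ∈ Set.Ioo (0 : ℝ) 1) (hq : q ∈ Set.Ioo (0 : ℝ) 1) :
    Tendsto (fun K : ℕ => Var[lagSum ξ 0 K; P] / K) atTop (𝓝 (meanVar n p q)) := by
  have h0 : p + q ≠ 0 := by linarith [hp.1, hq.1]
  refine ((isMarkovShift hp hq).tendsto_covariance_pair (fun x => (stat_pos hp hq x).le)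
    (sum_stat n p q) (sum_stat_mul_trans hp hq) (sum_trans_eigenLin h0) (sum_trans_eigenQuad h0)
    (abs_ff_lt_one hp hq) (abs_ff_sq_lt_one hp hq) sum_trans_const pairMean_meanTerm
    sum_trans_const pairMean_meanTerm).1.congr fun N => ?_
  have h1 := (h.ae_lagSum hp hq).mono fun ω hω => (hω N).1
  rw [← covariance_self (h.aemeasurable_lagSum hp hq N).1,
    h.covariance_eq hp hq h1 h1 (measurable_pathSum _ _) (measurable_pathSum _ _)]
  rfl

lemma tendsto_variance_prod (h : IsStationaryGraph P (geomLaw p) (geomLaw q) ξ)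
    (hp : p ∈ Set.Ioo (0 : ℝ) 1) (hq : q ∈ Set.Ioo (0 : ℝ) 1) :
    Tendsto (fun K : ℕ => Var[lagSum ξ 1 K; P] / K) atTop (𝓝 (prodVar n p q)) := by
  have h0 : p + q ≠ 0 := by linarith [hp.1, hq.1]
  rw [← tendsto_add_atTop_iff_nat 1]
  refine (tendsto_add_one_div_shift ((isMarkovShift hp hq).tendsto_covariance_pair
    (fun x => (stat_pos hp hq x).le)
    (sum_stat n p q) (sum_stat_mul_trans hp hq) (sum_trans_eigenLin h0) (sum_trans_eigenQuad h0)
    (abs_ff_lt_one hp hq) (abs_ff_sq_lt_one hp hq) sum_trans_mul pairMean_prodTerm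
    sum_trans_mul pairMean_prodTerm).1).congr fun N => ?_
  have h1 := (h.ae_lagSum hp hq).mono fun ω hω => (hω N).2
  rw [← covariance_self (h.aemeasurable_lagSum hp hq (N + 1)).2,
    h.covariance_eq hp hq h1 h1 (measurable_pathSum _ _) (measurable_pathSum _ _)]
  rfl

lemma tendsto_covariance_mean_prod (h : IsStationaryGraph P (geomLaw p) (geomLaw q) ξ)
    (hp : p ∈ Set.Ioo (0 : ℝ) 1) (hq : q ∈ Set.Ioo (0 : ℝ) 1) :
    Tendsto (fun K : ℕ => cov[lagSum ξ 0 K, lagSum ξ 1 K; P] / K) atTop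
      (𝓝 (mixedCov n p q)) := by
  have h0 : p + q ≠ 0 := by linarith [hp.1, hq.1]
  have hM := isMarkovShift (n := n) hp hq
  have := isProbabilityMeasure_graphLaw (n := n) hp hq
  rw [← tendsto_add_atTop_iff_nat 1]
  obtain ⟨h1, h2⟩ := hM.tendsto_covariance_pair
    (fun x => (stat_pos hp hq x).le)
    (sum_stat n p q) (sum_stat_mul_trans hp hq) (sum_trans_eigenLin h0) (sum_trans_eigenQuad h0)
    (abs_ff_lt_one hp hq) (abs_ff_sq_lt_one hp hq) sum_trans_const pairMean_meanTerm
    sum_trans_mul pairMean_prodTerm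
  -- The surplus summand `A(N + 1)` of the lag-zero sum has convergent covariance with the lag-one
  -- sum, hence contributes nothing after division.
  have h3 := (tendsto_add_one_div_shift h1).add
    (h2.div_atTop ((tendsto_natCast_atTop_atTop (R := ℝ)).comp (tendsto_add_atTop_nat 1)))
  rw [add_zero] at h3
  refine h3.congr fun N => ?_
  have h4 := (h.ae_lagSum hp hq).mono fun ω hω => (hω (N + 1)).1
  have h5 := (h.ae_lagSum hp hq).mono fun ω hω => (hω N).2
  rw [h.covariance_eq hp hq h4 h5 (measurable_pathSum _ _) (measurable_pathSum _ _)]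
  have h6 : pathSum (n := n) meanTerm (N + 1) = pathSum meanTerm N + pathTerm meanTerm N := by
    ext e
    exact Finset.sum_range_succ _ _
  have h7 : cov[pathSum meanTerm N + pathTerm meanTerm N, pathSum prodTerm N; graphLaw n p q]
      = cov[pathSum meanTerm N, pathSum prodTerm N; graphLaw n p q]
        + cov[pathTerm meanTerm N, pathSum prodTerm N; graphLaw n p q] :=
    covariance_add_left (hM.memLp_sum meanTerm N _) (hM.memLp_pair meanTerm N _)
      (hM.memLp_sum prodTerm N _)
  rw [h6, h7, add_div]
  rfl

/-- The difference between a linear functional of the scaled error and the normalized sum along the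
Markov chain is of smaller order. -/
lemma ae_abs_sub_le (h : IsStationaryGraph P (geomLaw p) (geomLaw q) ξ)
    (hp : p ∈ Set.Ioo (0 : ℝ) 1) (hq : q ∈ Set.Ioo (0 : ℝ) 1) (t t' r r' : ℝ) :
    ∃ B, ∀ K : ℕ, 2 ≤ K → ∀ᵐ ω ∂P,
      |t * (√(K : ℝ) * (muHat ξ 0 K ω - r)) + t' * (√(K : ℝ) * (muHat ξ 1 K ω - r'))
        - (√(K : ℝ))⁻¹ * pathSum (fun x y => t * (meanTerm x y - r) + t' * (prodTerm x y - r')) K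
          (fun j => ξ j ω)| ≤ B * (√(K : ℝ))⁻¹ := by
  obtain ⟨B, hB⟩ := Finite.exists_le
    fun s : (Fin n → Bool) × (Fin n → Bool) => |prodTerm s.1 s.2 - r'|
  replace hB : ∀ x y, |prodTerm (n := n) x y - r'| ≤ B := fun x y => hB (x, y)
  -- One `B` bounds the average of the centred products, the other the additional last product in
  -- the path sum; see `e3`.
  refine ⟨|t'| * (2 * B), fun K hK => ?_⟩
  obtain ⟨N, rfl⟩ : ∃ N, K = N + 1 := ⟨K - 1, by omega⟩
  filter_upwards [h.ae_lagSum hp hq] with ω hω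
  set e : Fin n → EdgeData := fun j => ξ j ω
  have hN : (0 : ℝ) < N := by exact_mod_cast (by omega : 0 < N)
  have hs : 0 < √((N + 1 : ℕ) : ℝ) := Real.sqrt_pos.2 (by positivity)
  have hs2 : √((N + 1 : ℕ) : ℝ) * √((N + 1 : ℕ) : ℝ) = N + 1 := by
    rw [Real.mul_self_sqrt (by positivity)]
    push_cast
    rfl
  set s := √((N + 1 : ℕ) : ℝ)
  have e0 : muHat ξ 0 (N + 1) ω - r = (pathSum meanTerm (N + 1) e - (N + 1) * r) / (N + 1) := by
    rw [muHat, (hω (N + 1)).1, Nat.sub_zero]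
    push_cast
    field_simp
  have e1 : muHat ξ 1 (N + 1) ω - r' = pathSum (fun x y => prodTerm x y - r') N e / N := by
    have h1 : pathSum (fun x y => prodTerm x y - r') N e = pathSum prodTerm N e - N * r' := by
      simp only [pathSum, pathTerm, Finset.sum_sub_distrib, Finset.sum_const, Finset.card_range,
        nsmul_eq_mul]
    rw [muHat, (hω N).2, Nat.add_sub_cancel, h1]
    field_simp
  have e2 : pathSum (fun x y => t * (meanTerm x y - r) + t' * (prodTerm x y - r')) (N + 1) e
      = t * (pathSum meanTerm (N + 1) e - (N + 1) * r)
        + t' * (pathSum (fun x y => prodTerm x y - r') N e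
          + pathTerm (fun x y => prodTerm x y - r') N e) := by
    have h1 : pathSum (fun x y => prodTerm x y - r') N e
        + pathTerm (fun x y => prodTerm x y - r') N e
        = pathSum (fun x y => prodTerm x y - r') (N + 1) e := (Finset.sum_range_succ _ _).symm
    rw [h1]
    simp only [pathSum, pathTerm, Finset.sum_add_distrib, ← Finset.mul_sum, Finset.sum_sub_distrib,
      Finset.sum_const, Finset.card_range, nsmul_eq_mul]
    push_cast
    ring
  -- The mean part cancels exactly. In the product part, dividing by `N` and not by `N + 1` leaves
  -- the average of the sum, from which the additional term is subtracted.
  have e3 : t * (s * (muHat ξ 0 (N + 1) ω - r)) + t' * (s * (muHat ξ 1 (N + 1) ω - r'))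
        - s⁻¹ * pathSum (fun x y => t * (meanTerm x y - r) + t' * (prodTerm x y - r')) (N + 1) e
      = t' * (pathSum (fun x y => prodTerm x y - r') N e / N
          - pathTerm (fun x y => prodTerm x y - r') N e) * s⁻¹ := by
    rw [e0, e1, e2, ← hs2]
    have hs3 : s ^ 2 = N + 1 := by rw [sq, hs2]
    field_simp
    rw [hs3]
    ring
  rw [e3, abs_mul, abs_mul, abs_of_pos (inv_pos.2 hs)]
  refine mul_le_mul_of_nonneg_right (mul_le_mul_of_nonneg_left ?_ (abs_nonneg _))
    (inv_pos.2 hs).le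
  have e4 : |pathSum (fun x y => prodTerm x y - r') N e / N| ≤ B := by
    rw [abs_div, abs_of_pos hN, div_le_iff₀ hN, mul_comm]
    exact abs_pathSum_le _ hB N e
  have e5 : |pathTerm (fun x y => prodTerm x y - r') N e| ≤ B := hB _ _
  exact (abs_sub _ _).trans (by linarith)

/-- The characteristic functions of the scaled errors converge, and their limit is Gaussian. -/
lemma tendsto_integral_exp_scaledError [IsProbabilityMeasure P]
    (h : IsStationaryGraph P (geomLaw p) (geomLaw q) ξ)
    (hp : p ∈ Set.Ioo (0 : ℝ) 1) (hq : q ∈ Set.Ioo (0 : ℝ) 1) (t t' : ℝ) :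
    0 ≤ t ^ 2 * meanVar n p q + 2 * t * t' * mixedCov n p q + t' ^ 2 * prodVar n p q ∧
    Tendsto (fun K : ℕ => ∫ ω, Complex.exp ((t * (√(K : ℝ) * (muHat ξ 0 K ω - lagMean P ξ 0))
        + t' * (√(K : ℝ) * (muHat ξ 1 K ω - lagMean P ξ 1)) : ℝ) * Complex.I) ∂P) atTop
      (𝓝 (Complex.exp (-(t ^ 2 * meanVar n p q + 2 * t * t' * mixedCov n p q
        + t' ^ 2 * prodVar n p q : ℝ) / 2))) := by
  have h0 : p + q ≠ 0 := by linarith [hp.1, hq.1]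
  have hM := isMarkovShift (n := n) hp hq
  let r := lagMean P ξ 0
  let r' := lagMean P ξ 1
  have hr : r = binMoment n p q 1 := h.lagMean_zero hp hq
  have hr' : r' = jointMoment1 n p q := h.lagMean_one hp hq
  have hφ := sum_trans_eigenLin (n := n) h0
  have hψ := sum_trans_eigenQuad (n := n) h0
  -- Centring at the exact means removes the constants, as the central limit theorem for the chain
  -- requires.
  have hd : ∀ x : Fin n → Bool,
      ∑ y, trans p q x y * (t * (meanTerm x y - r) + t' * (prodTerm x y - r'))
        = (t * 1 + t' * linCoef n p q) * eigenLin p q x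
          + (t * 0 + t' * ff p q) * eigenQuad p q x := fun x => by
    have h1 : ∀ y, trans p q x y * (t * (meanTerm x y - r) + t' * (prodTerm x y - r'))
        = t * (trans p q x y * onCount x) + t' * (trans p q x y * (onCount x * onCount y))
          - (t * r + t' * r') * trans p q x y := fun y => by
      rw [meanTerm, prodTerm]
      ring
    simp_rw [h1, Finset.sum_sub_distrib, Finset.sum_add_distrib, ← Finset.mul_sum,
      sum_trans_const, sum_trans_mul, sum_trans, hr, hr']
    ring
  have hmain := hM.tendsto_integral_exp (trans_pos hp hq) (fun x => (stat_pos hp hq x).le)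
    (sum_stat n p q) (sum_stat_mul_trans hp hq) hφ hψ (abs_ff_lt_one hp hq)
    (abs_ff_sq_lt_one hp hq) hd
  rw [asymCov_combination sum_trans (sum_stat n p q)
    (pairMean_eigenfunction (sum_stat_mul_trans hp hq) hφ
      (sub_ne_zero.1 (one_sub_ff_ne_zero hp hq)).symm)
    (pairMean_eigenfunction (sum_stat_mul_trans hp hq) hψ
      (sub_ne_zero.1 (one_sub_ff_sq_ne_zero hp hq)).symm)] at hmain
  refine ⟨hmain.1, ?_⟩
  obtain ⟨B, hB⟩ := h.ae_abs_sub_le hp hq t t' r r'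
  have hΞ := h.hasLaw hp hq
  have hW : ∀ K, Measurable (pathSum (fun x y : Fin n → Bool =>
      t * (meanTerm x y - r) + t' * (prodTerm x y - r')) K) := measurable_pathSum _
  have hU : ∀ K : ℕ, AEMeasurable (fun ω => t * (√(K : ℝ) * (muHat ξ 0 K ω - r))
      + t' * (√(K : ℝ) * (muHat ξ 1 K ω - r'))) P := fun K => by
    obtain ⟨h1, h2⟩ := h.aemeasurable_lagSum hp hq K
    unfold muHat
    fun_prop
  refine tendsto_integral_exp_of_abs_sub_le hU
    (fun K => ((hW K).comp_aemeasurable hΞ.aemeasurable).const_mul (√(K : ℝ))⁻¹)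
    (b := fun K => B * (√(K : ℝ))⁻¹) ?_ ?_ ?_
  · simpa using tendsto_inv_sqrt_natCast.const_mul B
  · filter_upwards [eventually_ge_atTop 2] with K hK using hB K hK
  · refine hmain.2.congr fun K => ?_
    have hm : Measurable fun e => Complex.exp (((√(K : ℝ))⁻¹ * pathSum (fun x y : Fin n → Bool =>
        t * (meanTerm x y - r) + t' * (prodTerm x y - r')) K e : ℝ) * Complex.I) := by
      have := hW K
      fun_prop
    exact (hΞ.integral_comp hm.aestronglyMeasurable).symm

end IsStationaryGraph

end Limits

end OnOff

/-! ### Proof of the theorem -/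

theorem proposition2 {Ω : Type*} [MeasurableSpace Ω] (P : Measure Ω) [IsProbabilityMeasure P]
    (n : ℕ) (p q : ℝ) (hp : p ∈ Set.Ioo (0 : ℝ) 1) (hq : q ∈ Set.Ioo (0 : ℝ) 1)
    (ξ : Fin n → Ω → OnOff.EdgeData)
    (hξ : OnOff.IsStationaryGraph P (OnOff.geomLaw p) (OnOff.geomLaw q) ξ) :
    ∃ v₀ v₁ c₀₁ : ℝ,
      -- joint asymptotic normality, with covariance matrix `(v₀, c₀₁; c₀₁, v₁)`
      (!![v₀, c₀₁; c₀₁, v₁] : Matrix (Fin 2) (Fin 2) ℝ).PosSemidef ∧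
      TendstoInDistribution (OnOff.scaledError P ξ) atTop id (fun _ => P)
        (multivariateGaussian 0 !![v₀, c₀₁; c₀₁, v₁]) ∧
      -- the entries are the limits of the normalized (co)variances
      Tendsto (fun K : ℕ => Var[OnOff.lagSum ξ 0 K; P] / K) atTop (𝓝 v₀) ∧
      Tendsto (fun K : ℕ => Var[OnOff.lagSum ξ 1 K; P] / K) atTop (𝓝 v₁) ∧
      Tendsto (fun K : ℕ => cov[OnOff.lagSum ξ 0 K, OnOff.lagSum ξ 1 K; P] / K) atTop (𝓝 c₀₁) ∧
      -- the closed forms of `v₀`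
      v₀ = n * OnOff.rho p q * (1 - OnOff.rho p q) * ((1 + OnOff.ff p q) / (1 - OnOff.ff p q)) ∧
      v₀ = n * (p * q * (2 - p - q) / (p + q) ^ 3) ∧
      -- the closed form of `v₁`
      Summable (fun k : ℕ => OnOff.lagCov P ξ (k + 2)) ∧
      v₁ = OnOff.lagCov P ξ 1 + 2 * ∑' k : ℕ, OnOff.lagCov P ξ (k + 2) ∧
      v₁ = OnOff.v1Cancelled n p q ∧
      (p + q ≠ 1 → v₁ = OnOff.v1Form n p q) ∧
      -- the closed form of `c₀₁`
      c₀₁ = OnOff.c01Cancelled n p q ∧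
      (p + q ≠ 1 → c₀₁ = OnOff.c01Form n p q) ∧
      -- the quantities in which these closed forms are expressed are the moments they stand for
      (∀ i : ℕ, ∫ ω, OnOff.edgeCount ξ 1 ω ^ i ∂P = OnOff.binMoment n p q i) ∧
      ∫ ω, OnOff.edgeCount ξ 1 ω * OnOff.edgeCount ξ 2 ω ∂P = OnOff.jointMoment1 n p q ∧
      ∫ ω, OnOff.edgeCount ξ 1 ω * OnOff.edgeCount ξ 2 ω ^ 2 ∂P = OnOff.jointMoment2 n p q ∧
      ∫ ω, OnOff.edgeCount ξ 1 ω * OnOff.edgeCount ξ 2 ω ^ 3 ∂P = OnOff.jointMoment3 n p q ∧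
      OnOff.lagCov P ξ 1 = OnOff.t1Form n p q := by
  have hff : p + q ≠ 1 → OnOff.ff p q ≠ 0 := fun h h' => h (by rw [OnOff.ff] at h'; linarith)
  have hexp := fun t t' : ℝ => hξ.tendsto_integral_exp_scaledError hp hq t t'
  have hquad : ∀ t : Fin 2 → ℝ, dotProduct t (Matrix.mulVec !![OnOff.meanVar n p q, OnOff.mixedCov n p q;
        OnOff.mixedCov n p q, OnOff.prodVar n p q] t)
      = t 0 ^ 2 * OnOff.meanVar n p q + 2 * t 0 * t 1 * OnOff.mixedCov n p q
        + t 1 ^ 2 * OnOff.prodVar n p q := fun t => by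
    simp only [Matrix.mulVec, dotProduct, Fin.sum_univ_two, Matrix.of_apply, Matrix.cons_val_zero,
      Matrix.cons_val_one, Matrix.cons_val']
    ring
  have hpsd : (!![OnOff.meanVar n p q, OnOff.mixedCov n p q;
      OnOff.mixedCov n p q, OnOff.prodVar n p q] : Matrix (Fin 2) (Fin 2) ℝ).PosSemidef := by
    refine Matrix.PosSemidef.of_dotProduct_mulVec_nonneg ?_ fun t => ?_
    · ext i j
      fin_cases i <;> fin_cases j <;> simp
    · rw [star_trivial, hquad]
      -- The quadratic form is the limit variance of a linear combination of the two sums.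
      exact (hexp _ _).1
  refine ⟨OnOff.meanVar n p q, OnOff.prodVar n p q, OnOff.mixedCov n p q, hpsd, ?_,
    hξ.tendsto_variance_mean hp hq, hξ.tendsto_variance_prod hp hq,
    hξ.tendsto_covariance_mean_prod hp hq, OnOff.meanVar_eq hp hq, OnOff.meanVar_eq' hp hq,
    ?_, ?_, OnOff.prodVar_eq_v1Cancelled hp hq, fun h => ?_, OnOff.mixedCov_eq hp hq, fun h => ?_,
    hξ.integral_edgeCount_pow hp hq, ?_, ?_, ?_, hξ.lagCov_one hp hq⟩
  · have hmeas : ∀ K, AEMeasurable (OnOff.scaledError P ξ K) P := fun K => by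
      obtain ⟨h1, h2⟩ := hξ.aemeasurable_lagSum hp hq K
      unfold OnOff.scaledError OnOff.muHat
      refine (WithLp.measurable_toLp 2 _).comp_aemeasurable (aemeasurable_pi_lambda _ fun i => ?_)
      fin_cases i
      · simp only [Fin.zero_eta, Matrix.cons_val_zero]
        fun_prop
      · simp only [Fin.mk_one, Matrix.cons_val_one, Matrix.cons_val_fin_one]
        fun_prop
    -- Lévy's continuity theorem: the characteristic function at `t` is the one-dimensional integral
    -- for the coefficients `t 0` and `t 1`.
    refine ⟨hmeas, aemeasurable_id, ProbabilityMeasure.tendsto_iff_tendsto_charFun.2 fun t => ?_⟩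
    simp only [ProbabilityMeasure.coe_mk, Measure.map_id]
    rw [charFun_multivariateGaussian hpsd, hquad]
    have h1 := (hexp (t 0) (t 1)).2
    refine (h1.congr fun K => ?_).trans_eq ?_
    · rw [charFun_apply, integral_map (hmeas K) (by fun_prop)]
      refine integral_congr_ae (ae_of_all _ fun ω => ?_)
      simp only [OnOff.scaledError, PiLp.inner_apply, Fin.sum_univ_two]
      simp
    · simp only [inner_zero_right, Complex.ofReal_zero, zero_mul, zero_sub, neg_div]
  · simp_rw [hξ.lagCov_add_two hp hq]
    exact (OnOff.hasSum_prodCovSucc hp hq).summable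
  · simp_rw [hξ.lagCov_add_two hp hq]
    rw [hξ.lagCov_one hp hq, (OnOff.hasSum_prodCovSucc hp hq).tsum_eq, OnOff.prodVar_eq]
  · rw [OnOff.prodVar_eq_v1Cancelled hp hq, OnOff.v1Cancelled_eq_v1Form (hff h)]
  · rw [OnOff.mixedCov_eq hp hq, OnOff.c01Cancelled_eq_c01Form (hff h)]
  · have h1 := hξ.integral_edgeCount_mul hp hq 1
    simp only [pow_one] at h1
    exact h1.trans OnOff.pairMean_jointMoment1
  · exact (hξ.integral_edgeCount_mul hp hq 2).trans OnOff.pairMean_jointMoment2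
  · exact (hξ.integral_edgeCount_mul hp hq 3).trans OnOff.pairMean_jointMoment3
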